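/- Let $L_{\mathcal O}=\{+,-,0,\mathcal O\}$, with $\mathcal O$ a ternary relation symbol. An oriented abelian group is an abelian group $A$ with a cyclic ternary relation $\mathcal O$ on $A$ that holds only for pairwise distinct elements and is preserved by translations, such that $x<_0y :\Leftrightarrow x\neq y\wedge \mathcal O(0,x,y)$ is a strict linear order on $A\setminus\{0\}$. It is regularly dense if for every prime $p$ and all $a,b\in A$ with $\mathcal O(0,a,b)$ there is $c\in A$ with $\mathcal O(a,pc,b)$ and $ic<_0(i+1)c$ for all $i\in\{1,\dots,p-1\}$. For a prime $p$, let $e(A,p)\in\mathbb N\cup\{\infty\}$ be the least $m$ with $\operatorname{Tor}_{p^{m+k}}(A)=\operatorname{Tor}_{p^m}(A)$ for all $k\in\mathbb N$, where $\operatorname{Tor}_{n}(A)=\{a\in A: na=0\}$, and $\infty$ if there is no such $m$. For a family $\vec e=(e_p)_{p\text{ prime}}$ with $e_p\in\{0,\infty\}$, let $T(\vec 0,\vec e)$ be the $L_{\mathcal O}$-theory whose models are the nontrivial divisible regularly dense oriented abelian groups $A$ with $e(A,p)=e_p$ for every prime $p$. A finite set $\Delta(x;\vec y)$ of partitioned formulas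 has uniform definability of types over finite sets (UDTFS) in a theory $T$ with $d$ parameters if there are finitely many families $F_i=(\varphi_i^{\sharp}(\vec y;\vec y_1,\dots,\vec y_d))_{\varphi\in\Delta}$ of formulas such that for every model $M$ of $T$, every nonempty finite $B\subseteq M^{|\vec y|}$ and every complete $\Delta(x;B)$-type $q$ in $M$ there are an $i$ and $\vec b_1,\dots,\vec b_d\in B$ such that for all $\varphi\in\Delta$ and $\vec b\in B$: $\varphi(x;\vec b)\in q$ if and only if $M\models\varphi_i^{\sharp}(\vec b;\vec b_1,\dots,\vec b_d)$. A theory $T$ has the VC $d$ property if $T$ is complete and every finite set of partitioned formulas in a single object variable $x$ has UDTFS in $T$ with $d$ parameters. Theorem. For every $\vec e=(e_p)_p$ with all $e_p\in\{0,\infty\}$ (in particular for $\vec e=\vec 0$ and $\vec e=\vec\infty$), the theory $T(\vec 0,\vec e)$ has the VC $1$ property. -/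

import Mathlib

open FirstOrder FirstOrder.Language

universe u v w

/-! ### Types over finite sets, UDTFS and the VC `d` property -/

namespace VCd

variable {L : FirstOrder.Language.{u, v}}

/-- A partitioned formula `φ(x; y)`, with object variables indexed by `α` and parameter
variables indexed by `β`, is a formula in the variables `α ⊕ β`.
`q` is a complete `Δ(x; B)`-type in `M`: it is a set of pairs `(φ, b)` with `φ ∈ Δ` and `b ∈ B`
(the pair `(φ, b)` stands for the instance `φ(x; b)`) such that every finite part of
`{φ(x; b) : (φ, b) ∈ q} ∪ {¬ φ(x; b) : (φ, b) ∉ q}` is realized in `M`. -/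
def IsCompleteType {α β : Type} (M : Type w) [L.Structure M] (Δ : Finset (L.Formula (α ⊕ β)))
    (B : Set (β → M)) (q : Set (L.Formula (α ⊕ β) × (β → M))) : Prop :=
  q ⊆ (Δ : Set (L.Formula (α ⊕ β))) ×ˢ B ∧
    ∀ s : Finset (L.Formula (α ⊕ β) × (β → M)),
      (s : Set (L.Formula (α ⊕ β) × (β → M))) ⊆ (Δ : Set (L.Formula (α ⊕ β))) ×ˢ B →
        ∃ a : α → M, ∀ r ∈ s, (r ∈ q ↔ r.1.Realize (Sum.elim a r.2))

/-- The family `F = (φ♯(y; y₁, …, y_d))_φ` of formulas, with the parameters `b₁, …, b_d`,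
defines the `Δ(x; B)`-type `q`: for all `φ ∈ Δ` and `b ∈ B`,
`φ(x; b) ∈ q` if and only if `M ⊨ φ♯(b; b₁, …, b_d)`. -/
def Defines {α β : Type} {d : ℕ} (M : Type w) [L.Structure M] (Δ : Finset (L.Formula (α ⊕ β)))
    (B : Set (β → M)) (F : L.Formula (α ⊕ β) → L.Formula (β ⊕ (Fin d × β)))
    (c : Fin d → β → M) (q : Set (L.Formula (α ⊕ β) × (β → M))) : Prop :=
  ∀ φ ∈ Δ, ∀ b ∈ B, (φ, b) ∈ q ↔ (F φ).Realize (Sum.elim b fun p => c p.1 p.2)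

/-- `Δ(x; y)` has uniform definability of types over finite sets in `T` with `d` parameters:
there are finitely many families `F₁, …, F_k` of formulas such that in every model `M` of `T`, for
every nonempty finite set `B` of parameter tuples, each complete `Δ(x; B)`-type is defined by some
`F_i` with parameters `b₁, …, b_d ∈ B`. -/
def HasUDTFS {α β : Type} (T : L.Theory) (Δ : Finset (L.Formula (α ⊕ β))) (d : ℕ) : Prop :=
  ∃ (k : ℕ) (F : Fin k → L.Formula (α ⊕ β) → L.Formula (β ⊕ (Fin d × β))),
    ∀ (M : Type w) [L.Structure M] [Nonempty M], M ⊨ T →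
      ∀ B : Set (β → M), B.Finite → B.Nonempty →
        ∀ q, IsCompleteType M Δ B q →
          ∃ (i : Fin k) (c : Fin d → β → M), (∀ j, c j ∈ B) ∧ Defines M Δ B (F i) c q

/-- The VC `d` property: `T` is a complete theory, and every finite set `Δ(x; y)` of partitioned
formulas in a single object variable has UDTFS in `T` with `d` parameters. -/
def HasVCProperty (T : L.Theory) (d : ℕ) : Prop :=
  T.IsComplete ∧
    ∀ (n : ℕ) (Δ : Finset (L.Formula (Fin 1 ⊕ Fin n))), HasUDTFS.{u, v, w} T Δ d

end VCd

/-! ### Oriented abelian groups -/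

namespace OrientedGroup

section Semantics

variable {A : Type w} [AddCommGroup A]

/-- The relation `x <₀ y`. -/
def lt₀ (O : A → A → A → Prop) (x y : A) : Prop := x ≠ y ∧ O 0 x y

/-- `O` is an orientation of the abelian group `A`: a cyclic relation between pairwise distinct
elements, preserved by translations, such that `<₀` is a strict linear order on `A \ {0}`. -/
structure IsOrientation (O : A → A → A → Prop) : Prop where
  distinct : ∀ a b c, O a b c → a ≠ b ∧ b ≠ c ∧ a ≠ c
  cyclic : ∀ a b c, O a b c → O b c a
  translate : ∀ a b c d, O a b c → O (a + d) (b + d) (c + d)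
  linear : IsStrictTotalOrder {x : A // x ≠ 0} (fun x y => lt₀ O x y)

/-- `A` is regularly dense. -/
def IsRegularlyDense (O : A → A → A → Prop) : Prop :=
  ∀ p : ℕ, p.Prime → ∀ a b : A, O 0 a b →
    ∃ c : A, O a (p • c) b ∧ ∀ i : ℕ, 1 ≤ i → i ≤ p - 1 → lt₀ O (i • c) ((i + 1) • c)

variable (A) in
/-- The invariant `e(A, p)`: the index at which the chain `Tor_{p⁰}(A) ≤ Tor_{p¹}(A) ≤ …` becomes
stationary, and `∞` if it does not (in `ℕ∞`, the infimum of the empty set is `∞`). -/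
noncomputable def torsionExponent (p : ℕ) : ℕ∞ :=
  sInf {e | ∃ m : ℕ, e = m ∧ ∀ k : ℕ,
    AddSubgroup.torsionBy A ((p : ℤ) ^ (m + k)) = AddSubgroup.torsionBy A ((p : ℤ) ^ m)}

end Semantics

/-- Function symbols `0`, `-` (unary) and `+` (binary). -/
inductive Func : ℕ → Type
  | zero : Func 0
  | neg : Func 1
  | add : Func 2

/-- The ternary relation symbol for the orientation. -/
inductive Rel : ℕ → Type
  | orient : Rel 3

/-- The language `L_O = {+, -, 0, O}`. -/
abbrev langO : FirstOrder.Language.{0, 0} := ⟨Func, Rel⟩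

/-- An abelian group with a ternary relation, as a structure in the language `L_O`. -/
@[reducible] def toStructure (A : Type w) [AddCommGroup A] (O : A → A → A → Prop) : langO.Structure A where
  funMap := fun f => match f with
    | Func.zero => fun _ => 0
    | Func.neg => fun x => - x 0
    | Func.add => fun x => x 0 + x 1
  RelMap := fun r => match r with
    | Rel.orient => fun x => O (x 0) (x 1) (x 2)

section Formulas

variable {γ : Type}

/-- The term `0`. -/
def zeroT : langO.Term γ := Term.func Func.zero ![]

/-- The term `-t`. -/
def negT (t : langO.Term γ) : langO.Term γ := Term.func Func.neg ![t]

/-- The term `s + t`. -/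
def addT (s t : langO.Term γ) : langO.Term γ := Term.func Func.add ![s, t]

/-- The term `n t = t + ⋯ + t`. -/
def smulT : ℕ → langO.Term γ → langO.Term γ
  | 0, _ => zeroT
  | n + 1, t => addT (smulT n t) t

variable {n : ℕ}

/-- The formula `O(r, s, t)`. -/
def orientF (r s t : langO.Term (γ ⊕ Fin n)) : langO.BoundedFormula γ n :=
  Relations.boundedFormula (L := langO) Rel.orient ![r, s, t]

/-- The formula `s <₀ t`. -/
def ltF (s t : langO.Term (γ ⊕ Fin n)) : langO.BoundedFormula γ n :=
  ∼(s =' t) ⊓ orientF zeroT s t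

end Formulas

/-- The axioms of nontrivial abelian groups. -/
def groupAxioms : langO.Theory :=
  {∀' ∀' ∀' (addT (addT (&0) (&1)) (&2) =' addT (&0) (addT (&1) (&2))),
   ∀' ∀' (addT (&0) (&1) =' addT (&1) (&0)),
   ∀' (addT (&0) zeroT =' &0),
   ∀' (addT (&0) (negT (&0)) =' zeroT),
   ∃' ∼(&0 =' zeroT)}

/-- The axioms of an orientation. The last two say that `<₀` is transitive, and that it is total on
the nonzero elements; it is irreflexive by definition. -/
def orientationAxioms : langO.Theory :=
  {∀' ∀' ∀' (orientF (&0) (&1) (&2) ⟹ (∼(&0 =' &1) ⊓ ∼(&1 =' &2) ⊓ ∼(&0 =' &2))),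
   ∀' ∀' ∀' (orientF (&0) (&1) (&2) ⟹ orientF (&1) (&2) (&0)),
   ∀' ∀' ∀' ∀' (orientF (&0) (&1) (&2) ⟹
     orientF (addT (&0) (&3)) (addT (&1) (&3)) (addT (&2) (&3))),
   ∀' ∀' ∀' (ltF (&0) (&1) ⊓ ltF (&1) (&2) ⟹ ltF (&0) (&2)),
   ∀' ∀' (∼(&0 =' zeroT) ⊓ ∼(&1 =' zeroT) ⊓ ∼(&0 =' &1) ⟹ ltF (&0) (&1) ⊔ ltF (&1) (&0))}

/-- Regular density at the prime `p`. -/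
noncomputable def regularlyDenseAxiom (p : ℕ) : langO.Sentence :=
  ∀' ∀' (orientF zeroT (&0) (&1) ⟹ ∃' (orientF (&0) (smulT p (&2)) (&1) ⊓
    BoundedFormula.iInf fun i : Fin (p - 1) =>
      ltF (smulT (i.1 + 1) (&2)) (smulT (i.1 + 1 + 1) (&2))))

/-- Divisibility by `p`. -/
def divisibleAxiom (p : ℕ) : langO.Sentence :=
  ∀' ∃' (smulT p (&1) =' &0)

/-- Every element killed by `p ^ (k + 1)` is killed by `p ^ k`. -/
def torsionStopAxiom (p k : ℕ) : langO.Sentence :=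
  ∀' (smulT (p ^ (k + 1)) (&0) =' zeroT ⟹ smulT (p ^ k) (&0) =' zeroT)

/-- The theory `T(0, e)` of nontrivial divisible regularly dense oriented abelian groups `A` with
`e(A, p) = e p` for all primes `p`. -/
noncomputable def theoryT (e : Nat.Primes → ℕ∞) : langO.Theory :=
  groupAxioms ∪ orientationAxioms ∪
    {σ | ∃ p : Nat.Primes, σ = regularlyDenseAxiom p} ∪
    {σ | ∃ p : Nat.Primes, σ = divisibleAxiom p} ∪
    {σ | ∃ (p : Nat.Primes) (k : ℕ), (k : ℕ∞) < e p ∧ σ = ∼(torsionStopAxiom p k)} ∪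
    {σ | ∃ (p : Nat.Primes) (k : ℕ), (k : ℕ∞) = e p ∧ σ = torsionStopAxiom p k}

section Realization

variable {M : Type w} [AddCommGroup M] (O : M → M → M → Prop) {γ : Type} {n : ℕ}

theorem realize_zeroT (v : γ → M) :
    letI := toStructure M O
    (zeroT (γ := γ)).realize v = (0 : M) := rfl

theorem realize_negT (v : γ → M) (t : langO.Term γ) :
    letI := toStructure M O
    (negT t).realize v = - t.realize v := rfl

theorem realize_addT (v : γ → M) (s t : langO.Term γ) :
    letI := toStructure M O
    (addT s t).realize v = s.realize v + t.realize v := rfl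

theorem realize_smulT (v : γ → M) (t : langO.Term γ) (m : ℕ) :
    letI := toStructure M O
    (smulT m t).realize v = m • t.realize v := by
  let _ := toStructure M O
  induction m with
  | zero => simp [smulT, realize_zeroT O]
  | succ m ih => rw [smulT, realize_addT O, ih, succ_nsmul]

theorem realize_orientF (v : γ → M) (xs : Fin n → M) (r s t : langO.Term (γ ⊕ Fin n)) :
    letI := toStructure M O
    (orientF r s t).Realize v xs ↔
      O (r.realize (Sum.elim v xs)) (s.realize (Sum.elim v xs)) (t.realize (Sum.elim v xs)) :=
  Iff.rfl

theorem realize_ltF (v : γ → M) (xs : Fin n → M) (s t : langO.Term (γ ⊕ Fin n)) :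
    letI := toStructure M O
    (ltF s t).Realize v xs ↔
      lt₀ O (s.realize (Sum.elim v xs)) (t.realize (Sum.elim v xs)) := by
  let _ := toStructure M O
  simp [ltF, lt₀, realize_orientF O, realize_zeroT O]

end Realization

theorem torsionBy_stop {A : Type w} [AddCommGroup A] {p m : ℕ}
    (h : ∀ x : A, p ^ (m + 1) • x = 0 → p ^ m • x = 0) (k : ℕ) :
    AddSubgroup.torsionBy A ((p : ℤ) ^ (m + k)) = AddSubgroup.torsionBy A ((p : ℤ) ^ m) := by
  have h' : ∀ (k : ℕ) (x : A), p ^ (m + k) • x = 0 → p ^ m • x = 0 := by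
    intro k
    induction k with
    | zero => exact fun x hx => hx
    | succ k ih =>
      intro x hx
      apply h
      rw [pow_succ, mul_smul]
      apply ih
      rw [← mul_smul, ← pow_succ]
      exact hx
  ext x
  have e1 : ∀ j : ℕ, x ∈ AddSubgroup.torsionBy A ((p : ℤ) ^ j) ↔ p ^ j • x = 0 := by
    intro j
    change ((p : ℤ) ^ j) • x = 0 ↔ _
    rw [← natCast_zsmul]
    push_cast
    rfl
  rw [e1, e1]
  refine ⟨h' k x, fun hx => ?_⟩
  rw [add_comm, pow_add, mul_smul, hx, smul_zero]

theorem torsionExponent_eq_iff {A : Type w} [AddCommGroup A] (p : ℕ) (e : ℕ∞) :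
    torsionExponent A p = e ↔
      (∀ k : ℕ, (k : ℕ∞) < e → ¬ ∀ x : A, p ^ (k + 1) • x = 0 → p ^ k • x = 0) ∧
      (∀ k : ℕ, (k : ℕ∞) = e → ∀ x : A, p ^ (k + 1) • x = 0 → p ^ k • x = 0) := by
  have e1 : ∀ (j : ℕ) (x : A), x ∈ AddSubgroup.torsionBy A ((p : ℤ) ^ j) ↔ p ^ j • x = 0 := by
    intro j x
    change ((p : ℤ) ^ j) • x = 0 ↔ _
    rw [← natCast_zsmul]
    push_cast
    rfl
  have e2 : ∀ m : ℕ, (∀ k : ℕ,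
      AddSubgroup.torsionBy A ((p : ℤ) ^ (m + k)) = AddSubgroup.torsionBy A ((p : ℤ) ^ m)) ↔
      ∀ x : A, p ^ (m + 1) • x = 0 → p ^ m • x = 0 := by
    refine fun m => ⟨fun h x hx => ?_, torsionBy_stop⟩
    rw [← e1, ← h 1, e1]
    exact hx
  simp only [torsionExponent, e2]
  constructor
  · rintro rfl
    refine ⟨fun k hk h => absurd hk (not_lt_of_ge (sInf_le ?_)), fun k hk => ?_⟩
    · exact ⟨k, rfl, h⟩
    have hne : {e : ℕ∞ | ∃ m : ℕ, e = m ∧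
        ∀ x : A, p ^ (m + 1) • x = 0 → p ^ m • x = 0}.Nonempty := by
      by_contra hcon
      rw [Set.not_nonempty_iff_eq_empty] at hcon
      rw [hcon, sInf_empty] at hk
      exact ENat.natCast_ne_top k hk
    obtain ⟨m, hm, hm'⟩ := csInf_mem hne
    rw [← hk] at hm
    rw [Nat.cast_inj.mp hm]
    exact hm'
  · rintro ⟨h1, h2⟩
    apply le_antisymm
    · induction e with
      | top => exact le_top
      | coe m => exact sInf_le ⟨m, rfl, h2 m rfl⟩
    · refine le_sInf ?_
      rintro _ ⟨m, rfl, hm⟩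
      exact le_of_not_gt fun hlt => h1 m hlt hm

/-- The models of `theoryT e` are the nontrivial regularly dense oriented abelian groups `A` with
`[p]A = 1` and `e(A, p) = e p` for all primes `p`. -/
theorem model_theoryT_iff (e : Nat.Primes → ℕ∞) (M : Type w) [S : langO.Structure M] :
    M ⊨ theoryT e ↔ ∃ (_ : AddCommGroup M) (O : M → M → M → Prop),
      S = toStructure M O ∧ Nontrivial M ∧ IsOrientation O ∧ IsRegularlyDense O ∧
      (∀ p : Nat.Primes, (nsmulAddMonoidHom (α := M) p).range.index = 1) ∧
      (∀ p : Nat.Primes, torsionExponent M p = e p) := by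
  have key : ∀ (_ : AddCommGroup M) (O : M → M → M → Prop), S = toStructure M O →
      (M ⊨ theoryT e ↔ Nontrivial M ∧ IsOrientation O ∧ IsRegularlyDense O ∧
      (∀ p : Nat.Primes, (nsmulAddMonoidHom (α := M) p).range.index = 1) ∧
      (∀ p : Nat.Primes, torsionExponent M p = e p)) := by
    rintro G O rfl
    let _ := toStructure M O
    have hG : M ⊨ groupAxioms ↔ Nontrivial M := by
      simp [groupAxioms, Theory.model_iff, Sentence.Realize, Formula.Realize, realize_addT O,
        realize_negT O, realize_zeroT O, Fin.snoc, add_comm, nontrivial_iff_exists_ne (0 : M)]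
      intros; abel
    have hO : M ⊨ orientationAxioms ↔ IsOrientation O := by
      simp [orientationAxioms, Theory.model_iff, Sentence.Realize, Formula.Realize, realize_addT O,
        realize_orientF O, realize_ltF O, realize_zeroT O, Fin.snoc]
      constructor
      · rintro ⟨h1, h2, h3, h4, h5⟩
        refine ⟨fun a b c h => ⟨(h1 a b c h).1.1, (h1 a b c h).1.2, (h1 a b c h).2⟩, h2, h3,
          { trichotomous := fun a b hab hba => ?_
            irrefl := fun a h => h.1 rfl
            trans := fun a b c => h4 a b c }⟩
        by_contra hne
        rcases h5 a b a.2 b.2 (fun h => hne (Subtype.ext h)) with h | h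
        exacts [hab h, hba h]
      · rintro ⟨h1, h2, h3, h4⟩
        refine ⟨fun a b c h => ⟨⟨(h1 a b c h).1, (h1 a b c h).2.1⟩, (h1 a b c h).2.2⟩, h2, h3,
          fun a b c hab hbc => ?_, fun a b ha hb hab => ?_⟩
        · exact h4.trans ⟨a, (h1 _ _ _ hab.2).1.symm⟩ ⟨b, (h1 _ _ _ hbc.2).1.symm⟩
            ⟨c, (h1 _ _ _ hbc.2).2.2.symm⟩ hab hbc
        · by_contra hcon
          rw [not_or] at hcon
          exact hab (congrArg Subtype.val
            (h4.trichotomous ⟨a, ha⟩ ⟨b, hb⟩ hcon.1 hcon.2))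
    have hR : M ⊨ {σ | ∃ p : Nat.Primes, σ = regularlyDenseAxiom p} ↔ IsRegularlyDense O := by
      simp [Theory.model_iff, regularlyDenseAxiom, Sentence.Realize, Formula.Realize,
        realize_orientF O, realize_ltF O, realize_zeroT O, realize_smulT O, Fin.snoc, IsRegularlyDense]
      constructor
      · intro h p hp a b hab
        obtain ⟨c, hc, hc'⟩ := h ⟨p, hp⟩ a b hab
        refine ⟨c, hc, fun i hi hi' => ?_⟩
        obtain ⟨j, rfl⟩ := Nat.exists_eq_add_of_le' hi
        exact hc' ⟨j, hi'⟩
      · intro h p a b hab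
        obtain ⟨c, hc, hc'⟩ := h p p.2 a b hab
        exact ⟨c, hc, fun i => hc' _ (Nat.le_add_left _ _) i.2⟩
    have hD : M ⊨ {σ | ∃ p : Nat.Primes, σ = divisibleAxiom p} ↔
        (∀ p : Nat.Primes, (nsmulAddMonoidHom (α := M) p).range.index = 1) := by
      simp [Theory.model_iff, divisibleAxiom, Sentence.Realize, Formula.Realize,
        realize_smulT O, Fin.snoc, AddSubgroup.eq_top_iff']
    have hE : ∀ p k, M ⊨ torsionStopAxiom p k ↔ ∀ x : M, p ^ (k + 1) • x = 0 → p ^ k • x = 0 := by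
      intro p k
      simp [torsionStopAxiom, Sentence.Realize, Formula.Realize,
        realize_zeroT O, realize_smulT O, Fin.snoc]
    have hT : (M ⊨ {σ | ∃ (p : Nat.Primes) (k : ℕ), (k : ℕ∞) < e p ∧ σ = ∼(torsionStopAxiom p k)} ∧
        M ⊨ {σ | ∃ (p : Nat.Primes) (k : ℕ), (k : ℕ∞) = e p ∧ σ = torsionStopAxiom p k}) ↔
        (∀ p : Nat.Primes, torsionExponent M p = e p) := by
      simp only [torsionExponent_eq_iff, ← hE, forall_and, Theory.model_iff]
      constructor
      · rintro ⟨h1, h2⟩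
        exact ⟨fun p k hk => (Sentence.realize_not M).1 (h1 _ ⟨p, k, hk, rfl⟩),
          fun p k hk => h2 _ ⟨p, k, hk, rfl⟩⟩
      · rintro ⟨h1, h2⟩
        refine ⟨?_, ?_⟩
        · rintro _ ⟨p, k, hk, rfl⟩
          exact (Sentence.realize_not M).2 (h1 p k hk)
        · rintro _ ⟨p, k, hk, rfl⟩
          exact h2 p k hk
    simp only [theoryT, Theory.model_union_iff, hG, hO, hR, hD, ← hT, and_assoc]
  refine ⟨fun h => ?_, fun ⟨G, O, hS, h⟩ => (key G O hS).2 h⟩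
  have hg : M ⊨ groupAxioms := h.mono (by intro σ hσ; simp [theoryT, hσ])
  have hadd : ∀ {γ : Type} (v : γ → M) (s t : langO.Term γ), (addT s t).realize v =
      S.funMap Func.add ![s.realize v, t.realize v] := by
    intro γ v s t
    rw [addT, Term.realize_func]
    congr 1
    ext i
    fin_cases i <;> rfl
  have hneg : ∀ {γ : Type} (v : γ → M) (t : langO.Term γ), (negT t).realize v =
      S.funMap Func.neg ![t.realize v] := by
    intro γ v t
    rw [negT, Term.realize_func]
    congr 1
    ext i
    fin_cases i
    rfl
  have hzero : ∀ {γ : Type} (v : γ → M), (zeroT (γ := γ)).realize v = S.funMap Func.zero ![] := by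
    intro γ v
    rw [zeroT, Term.realize_func]
    congr 1
    ext i
    exact i.elim0
  simp [groupAxioms, Theory.model_iff, Sentence.Realize, Formula.Realize, hadd, hneg, hzero,
    Fin.snoc] at hg
  obtain ⟨g1, g2, g3, g4, -⟩ := hg
  let _ : Add M := ⟨fun a b => S.funMap Func.add ![a, b]⟩
  let _ : Zero M := ⟨S.funMap Func.zero ![]⟩
  let _ : Neg M := ⟨fun a => S.funMap Func.neg ![a]⟩
  let G : AddCommGroup M :=
    {
      add_assoc := g1
      add_comm := g2
      add_zero := g3
      zero_add := fun a => (g2 _ _).trans (g3 a)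
      neg_add_cancel := fun a => (g2 _ _).trans (g4 a)
      nsmul := nsmulRec
      zsmul := zsmulRec }
  have hS : S = toStructure M fun a b c => S.RelMap Rel.orient ![a, b, c] := by
    apply Structure.ext
    · funext n f x
      cases f
      · exact congrArg (S.funMap Func.zero) (funext fun i => i.elim0)
      · exact congrArg (S.funMap Func.neg) (funext fun i => by fin_cases i; rfl)
      · exact congrArg (S.funMap Func.add) (funext fun i => by fin_cases i <;> rfl)
    · funext n r x
      cases r
      exact congrArg (S.RelMap Rel.orient) (funext fun i => by fin_cases i <;> rfl)
  exact ⟨G, _, hS, (key G _ hS).1 h⟩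

end OrientedGroup

/-! An oriented abelian group `A` is a circle, and the proof unrolls it. Cutting the circle at `0`
gives a linear order with least element `0`. The carry of addition with respect to this cut is a
symmetric 2-cocycle with values in {0, 1}, and the extension `Cover h` of `A` by ℤ that it defines
is a linearly ordered abelian group G with a distinguished u > 0, the full turn (`turn`). Then `A`
is G/ℤu, and each element of `A` has a unique lift in [0, u). In G the axioms become linear:
divisibility says that every element is divisible by m up to a multiple of u, regular density says
that every mG is dense, and for `e p` in {0, ∞} the invariant says whether u is in pG.

The core is a relative quantifier elimination (`exists_realize_iff_of_similar`). The truth of a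
formula at a tuple depends only on the signs of the integral affine forms in the lifts with
coefficients up to some B, and on residues modulo some M, the residue of z being a t with z + tu in
MG. The quantifier step is the one-point extension `Similar.exists_extension`: with L a common
multiple of 1, ..., B, the sign conditions on a new point c only concern the cut of Lc among
finitely many forms in the old points. If Lc equals a form, its counterpart is determined and exists
by residues modulo LM; otherwise density fills the cut in any prescribed residue class. Residues
transfer between models because the exponents `e p` decide which ku lie in mG
(`zsmul_turn_eq_smul`). For sentences there are no variables left, so any two models agree; with a
model built from a subgroup of ℝ modulo ℤ this gives completeness.

For definability of types, each form contains a single parameter tuple. So the type of `a` over a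
finite set is determined by the residue of its lift and by the position of L · lift `a` among
finitely many values, each coming from one tuple. If it equals a value, that tuple defines the type
(`AtPoint`). Otherwise the tuple giving the greatest value below suffices (`RightOf`): an instance
holds at `a` if and only if it holds at all points of the same residue class close enough above that
value. The neighbour above is thus never needed, which is why one parameter is enough. The
coefficients and the residue range over a finite set, whence finitely many families. -/

namespace OrientedGroup

/-! ### Cutting the cyclic order to a linear order. -/

section Cut

variable {A : Type w} [AddCommGroup A] {O : A → A → A → Prop}

namespace IsOrientation

theorem translate_iff (h : IsOrientation O) (d : A) {a b c : A} :
    O (a + d) (b + d) (c + d) ↔ O a b c :=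
  ⟨fun H => by simpa using h.translate _ _ _ (-d) H, h.translate a b c d⟩

theorem asymm (h : IsOrientation O) {x a b : A} (hab : O x a b) : ¬ O x b a := by
  intro hba
  have h1 := h.translate _ _ _ (-x) hab
  have h2 := h.translate _ _ _ (-x) hba
  rw [add_neg_cancel] at h1 h2
  have d1 := h.distinct _ _ _ h1
  exact h.linear.irrefl _ (h.linear.trans ⟨a + -x, d1.1.symm⟩ ⟨b + -x, d1.2.2.symm⟩ ⟨a + -x, d1.1.symm⟩
    ⟨d1.2.1, h1⟩ ⟨d1.2.1.symm, h2⟩)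

theorem trans (h : IsOrientation O) {x a b c : A} (hab : O x a b) (hbc : O x b c) : O x a c := by
  have h1 := h.translate _ _ _ (-x) hab
  have h2 := h.translate _ _ _ (-x) hbc
  rw [add_neg_cancel] at h1 h2
  have d1 := h.distinct _ _ _ h1
  have d2 := h.distinct _ _ _ h2
  have := (h.linear.trans ⟨a + -x, d1.1.symm⟩ ⟨b + -x, d1.2.2.symm⟩ ⟨c + -x, d2.2.2.symm⟩
    ⟨d1.2.1, h1⟩ ⟨d2.2.1, h2⟩).2
  rw [← h.translate_iff (-x), add_neg_cancel]
  exact this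

theorem total (h : IsOrientation O) {x a b : A} (ha : x ≠ a) (hb : x ≠ b) (hab : a ≠ b) :
    O x a b ∨ O x b a := by
  have e : ∀ y, x ≠ y → y + -x ≠ 0 := fun y hy h0 => hy (add_neg_eq_zero.1 h0).symm
  rw [← h.translate_iff (-x), ← h.translate_iff (-x) (b := b), add_neg_cancel]
  by_contra hcon
  rw [not_or] at hcon
  have := h.linear.trichotomous ⟨a + -x, e a ha⟩ ⟨b + -x, e b hb⟩ (fun H => hcon.1 H.2)
    (fun H => hcon.2 H.2)
  exact hab (by simpa using congrArg Subtype.val this)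

/-- Otherwise translations of the two orientations would give both chains -b < a - b < a < b and b <
b - a < -a < -b. -/
theorem neg_rev (h : IsOrientation O) {a b : A} (hab : O 0 a b) : O 0 (-b) (-a) := by
  have key : ∀ {a b : A}, O 0 a b → O 0 (-b) (a - b) ∧ O 0 (b - a) (-a) := by
    intro a b hab
    have h1 := h.translate _ _ _ (-a) hab
    have h2 := h.translate _ _ _ (-b) hab
    rw [add_neg_cancel, zero_add, ← sub_eq_add_neg] at h1 h2
    exact ⟨h.cyclic _ _ _ (h.cyclic _ _ _ h2), h.cyclic _ _ _ h1⟩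
  obtain ⟨d1, d2, d3⟩ := h.distinct _ _ _ hab
  refine (h.total (x := 0) (a := -a) (b := -b) ?_ ?_ ?_).resolve_left fun hc => ?_
  · simpa [eq_comm] using d1
  · simpa [eq_comm] using d3
  · simpa using d2
  · obtain ⟨k1, k2⟩ := key hab
    obtain ⟨k3, k4⟩ := key hc
    rw [neg_neg, neg_sub_neg] at k3
    rw [neg_neg, neg_sub_neg] at k4
    exact h.asymm (h.trans (h.trans k1 k4) hab) (h.trans k3 (h.trans k2 hc))

end IsOrientation

/-- The linear order on `A` with least element `0` obtained by cutting the orientation at `0`. -/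
def Cut (O : A → A → A → Prop) (x y : A) : Prop := (x = 0 ∧ y ≠ 0) ∨ O 0 x y

namespace IsOrientation

theorem cut_irrefl (h : IsOrientation O) (x : A) : ¬ Cut O x x := by
  rintro (⟨h1, h2⟩ | h1)
  · exact h2 h1
  · exact (h.distinct _ _ _ h1).2.1 rfl

theorem cut_trans (h : IsOrientation O) {x y z : A} (h1 : Cut O x y) (h2 : Cut O y z) :
    Cut O x z := by
  have := h.distinct
  have := @h.trans
  unfold Cut at *
  grind

theorem cut_total (h : IsOrientation O) {x y : A} (hxy : x ≠ y) : Cut O x y ∨ Cut O y x := by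
  have := @h.total
  unfold Cut
  grind

/-- Cutting loses nothing: the cyclic order is that of the rotations of increasing triples. This
turns questions about `O` into questions about a linear order. -/
theorem iff_cut (h : IsOrientation O) {a b c : A} :
    O a b c ↔ (Cut O a b ∧ Cut O b c) ∨ (Cut O b c ∧ Cut O c a) ∨ (Cut O c a ∧ Cut O a b) := by
  have hr : ∀ {a b c : A}, O a b c → O b c a := fun H => h.cyclic _ _ _ H
  have h1 : ∀ {a b c : A}, Cut O a b → Cut O b c → O a b c := by
    intro a b c hab hbc
    rcases hab with ⟨rfl, hb⟩ | hab
    · rcases hbc with ⟨rfl, hc⟩ | hbc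
      · exact absurd rfl hb
      · exact hbc
    · rcases hbc with ⟨rfl, hc⟩ | hbc
      · exact absurd rfl (h.distinct _ _ _ hab).2.2
      · exact hr (hr (h.trans (hr hbc) (hr (hr hab))))
  constructor
  · intro H
    obtain ⟨d1, d2, d3⟩ := h.distinct _ _ _ H
    have hn : ¬ O a c b := h.asymm H
    rcases h.cut_total d1 with hab | hba <;> rcases h.cut_total d2 with hbc | hcb <;>
      rcases h.cut_total d3 with hac | hca
    · exact .inl ⟨hab, hbc⟩
    · exact .inl ⟨hab, hbc⟩
    · exact absurd (h1 hac hcb) hn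
    · exact .inr (.inr ⟨hca, hab⟩)
    · exact absurd (hr (h1 hba hac)) hn
    · exact .inr (.inl ⟨hbc, hca⟩)
    · exact absurd (hr (h1 hba hac)) hn
    · exact absurd (hr (hr (h1 hcb hba))) hn
  · rintro (⟨h2, h3⟩ | ⟨h2, h3⟩ | ⟨h2, h3⟩)
    · exact h1 h2 h3
    · exact hr (hr (h1 h2 h3))
    · exact hr (h1 h2 h3)

theorem cut_asymm (h : IsOrientation O) {x y : A} (h1 : Cut O x y) : ¬ Cut O y x :=
  fun h2 => h.cut_irrefl _ (h.cut_trans h1 h2)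

theorem not_cut_zero (h : IsOrientation O) (x : A) : ¬ Cut O x 0 := by
  rintro (⟨-, h2⟩ | h1)
  · exact h2 rfl
  · exact (h.distinct _ _ _ h1).2.2 rfl

theorem cut_add_left_iff (h : IsOrientation O) {x y : A} :
    Cut O (x + y) x ↔ x ≠ 0 ∧ y ≠ 0 ∧ (x + y = 0 ∨ O 0 (-x) y) := by
  have e : O 0 (x + y) x ↔ O 0 (-x) y := by
    rw [← h.translate_iff x (a := 0) (b := -x), zero_add, neg_add_cancel, add_comm y x]
    exact ⟨fun H => h.cyclic _ _ _ (h.cyclic _ _ _ H), fun H => h.cyclic _ _ _ H⟩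
  unfold Cut
  rw [e]
  constructor
  · rintro (⟨h1, h2⟩ | h1)
    · refine ⟨h2, ?_, .inl h1⟩
      rintro rfl
      exact h2 (by simpa using h1)
    · obtain ⟨d1, d2, d3⟩ := h.distinct _ _ _ h1
      exact ⟨by simpa [eq_comm] using d1, d3.symm, .inr h1⟩
  · rintro ⟨h1, h2, h3 | h3⟩
    · exact .inl ⟨h3, h1⟩
    · exact .inr h3

/-- The sum overflows when `y` reaches or passes `-x`, and `neg_rev` makes this condition symmetric.
-/
theorem cut_add_comm (h : IsOrientation O) {x y : A} : Cut O (x + y) x ↔ Cut O (y + x) y := by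
  have : ∀ {x y : A}, O 0 (-x) y → O 0 (-y) x := fun H => by simpa using h.neg_rev H
  rw [h.cut_add_left_iff, h.cut_add_left_iff, add_comm y x]
  have h1 := @this x y
  have h2 := @this y x
  tauto

end IsOrientation

/-! ### The carry cocycle and the universal cover. -/

open Classical in
/-- The carry of the addition of `A`, viewed as addition modulo the full turn. -/
noncomputable def carry (O : A → A → A → Prop) (x y : A) : ℤ := if Cut O (x + y) x then 1 else 0

namespace IsOrientation

theorem carry_comm (h : IsOrientation O) (x y : A) : carry O x y = carry O y x := by
  unfold carry
  rw [h.cut_add_comm]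

theorem carry_zero (h : IsOrientation O) (x : A) : carry O x 0 = 0 := by
  simp [carry, h.cut_irrefl]

theorem carry_assoc (h : IsOrientation O) (x y z : A) :
    carry O x y + carry O (x + y) z = carry O y z + carry O x (y + z) := by
  -- Translation by `x` expresses the carry of `y` and `z` through the points x, x + y, x + y + z.
  -- The other three carries compare the same points, so the cocycle identity is a finite check on
  -- three points of a linear order.
  have e : Cut O (y + z) y ↔ (x + y + z = x ∧ x + y ≠ x) ∨ O x (x + y + z) (x + y) := by
    have e1 : x + y + z + -x = y + z := by abel
    have e2 : x + y + -x = y := by abel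
    rw [← h.translate_iff (-x), e1, e2, add_neg_cancel]
    unfold Cut
    simp [add_assoc]
  unfold carry
  rw [← add_assoc, e, h.iff_cut]
  generalize x + y + z = d
  generalize x + y = b
  have i1 := h.cut_irrefl d
  have i2 := h.cut_irrefl b
  have i3 := h.cut_irrefl x
  have a1 := @h.cut_asymm _ _ _ b x
  have a2 := @h.cut_asymm _ _ _ d b
  have a3 := @h.cut_asymm _ _ _ d x
  have t1 := @h.cut_trans _ _ _ b d x
  have t2 := @h.cut_trans _ _ _ d b x
  have t3 := @h.cut_trans _ _ _ b x d
  have t4 := @h.cut_trans _ _ _ d x b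
  have t5 := @h.cut_trans _ _ _ x b d
  have t6 := @h.cut_trans _ _ _ x d b
  have c1 := @h.cut_total _ _ _ b x
  have c2 := @h.cut_total _ _ _ d x
  have c3 := @h.cut_total _ _ _ d b
  split_ifs <;> grind

theorem carry_nonneg (x y : A) : 0 ≤ carry O x y := by
  unfold carry; split <;> simp

theorem carry_le_one (x y : A) : carry O x y ≤ 1 := by
  unfold carry; split <;> simp

open Classical in
theorem carry_neg (h : IsOrientation O) (x : A) : carry O x (-x) = if x = 0 then 0 else 1 := by
  unfold carry
  by_cases hx : x = 0
  · simp [hx, h.cut_irrefl]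
  · simp [hx, Cut]

end IsOrientation

/-- The universal cover of an oriented abelian group: the extension of `A` by `ℤ` that the carry
defines. -/
@[ext]
structure Cover {O : A → A → A → Prop} (h : IsOrientation O) where
  int : ℤ
  frac : A

namespace Cover

variable {h : IsOrientation O}

noncomputable instance : Add (Cover h) :=
  ⟨fun x y => ⟨x.int + y.int + carry O x.frac y.frac, x.frac + y.frac⟩⟩

noncomputable instance : Zero (Cover h) := ⟨⟨0, 0⟩⟩

noncomputable instance : Neg (Cover h) := ⟨fun x => ⟨- x.int - carry O x.frac (- x.frac), - x.frac⟩⟩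

theorem int_add (x y : Cover h) : (x + y).int = x.int + y.int + carry O x.frac y.frac := rfl
theorem frac_add (x y : Cover h) : (x + y).frac = x.frac + y.frac := rfl
theorem int_zero : (0 : Cover h).int = 0 := rfl
theorem frac_zero : (0 : Cover h).frac = 0 := rfl
theorem int_neg (x : Cover h) : (-x).int = - x.int - carry O x.frac (- x.frac) := rfl
theorem frac_neg (x : Cover h) : (-x).frac = - x.frac := rfl

noncomputable instance : AddCommGroup (Cover h) where
  add_assoc x y z := by
    ext
    · have := h.carry_assoc x.frac y.frac z.frac
      simp only [int_add, frac_add]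
      linarith
    · simp only [frac_add, add_assoc]
  add_comm x y := by
    ext
    · simp only [int_add, h.carry_comm x.frac y.frac]; ring
    · simp only [frac_add, add_comm]
  zero_add x := by
    ext
    · simp [int_add, int_zero, frac_zero, h.carry_comm 0, h.carry_zero]
    · simp [frac_add, frac_zero]
  add_zero x := by
    ext
    · simp [int_add, int_zero, frac_zero, h.carry_zero]
    · simp [frac_add, frac_zero]
  neg_add_cancel x := by
    ext
    · simp only [int_add, int_neg, frac_neg, h.carry_comm (-x.frac), int_zero]; ring
    · simp [frac_add, frac_neg, frac_zero]
  nsmul := nsmulRec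
  zsmul := zsmulRec

/-- The elements of the cover with nonnegative integer part form its positive cone. -/
def cone (h : IsOrientation O) : AddGroupCone (Cover h) where
  carrier := {x | 0 ≤ x.int}
  add_mem' {x y} hx hy := by
    have := IsOrientation.carry_nonneg (O := O) x.frac y.frac
    simp only [Set.mem_ofPred_eq, int_add] at *
    omega
  zero_mem' := le_refl (0 : ℤ)
  eq_zero_of_mem_of_neg_mem' {x} hx hy := by
    simp only [Set.mem_ofPred_eq, int_neg, h.carry_neg] at hx hy
    split_ifs at hy with h0
    · ext
      · rw [int_zero]; omega
      · exact h0
    · omega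

theorem mem_cone {x : Cover h} : x ∈ cone h ↔ 0 ≤ x.int := Iff.rfl

instance : HasMemOrNegMem (cone h) where
  mem_or_neg_mem x := by
    have := IsOrientation.carry_le_one (O := O) x.frac (-x.frac)
    simp only [mem_cone, int_neg]
    omega

open Classical in
noncomputable instance : LinearOrder (Cover h) := LinearOrder.mkOfAddGroupCone (cone h)

instance : IsOrderedAddMonoid (Cover h) := IsOrderedAddMonoid.mkOfCone (cone h)

theorem nonneg_iff {x : Cover h} : 0 ≤ x ↔ 0 ≤ x.int := by
  change x - 0 ∈ cone h ↔ _
  rw [sub_zero, mem_cone]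

/-- The full turn. -/
noncomputable def turn (h : IsOrientation O) : Cover h := ⟨1, 0⟩

/-- The lift of an element of `A` to the interval from `0` to the full turn. -/
def lift (h : IsOrientation O) (a : A) : Cover h := ⟨0, a⟩

@[simp] theorem int_lift (a : A) : (lift h a).int = 0 := rfl
@[simp] theorem frac_lift (a : A) : (lift h a).frac = a := rfl
@[simp] theorem lift_zero : lift h 0 = 0 := rfl
@[simp] theorem int_turn : (turn h).int = 1 := rfl
@[simp] theorem frac_turn : (turn h).frac = 0 := rfl

theorem lift_injective : Function.Injective (lift h) := fun _ _ H => congrArg Cover.frac H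

theorem lift_inj {a b : A} : lift h a = lift h b ↔ a = b := lift_injective.eq_iff

variable (h) in
/-- The projection of the cover onto `A`. -/
@[simps] def fracHom : Cover h →+ A where
  toFun := frac
  map_zero' := rfl
  map_add' _ _ := rfl

theorem frac_zsmul (n : ℤ) (x : Cover h) : (n • x).frac = n • x.frac := map_zsmul (fracHom h) n x
theorem frac_sub (x y : Cover h) : (x - y).frac = x.frac - y.frac := map_sub (fracHom h) x y

theorem int_add_turn (x : Cover h) : (x + turn h).int = x.int + 1 := by
  simp [int_add, h.carry_zero]

theorem add_zsmul_turn (x : Cover h) (n : ℤ) : x + n • turn h = ⟨x.int + n, x.frac⟩ := by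
  induction n with
  | zero => ext <;> simp
  | succ n ih =>
    rw [add_zsmul, ← add_assoc, ih, one_zsmul]
    ext
    · rw [int_add_turn]; ring
    · simp [frac_add]
  | pred n ih =>
    rw [show -(n : ℤ) - 1 = -(n : ℤ) + -1 from rfl, add_zsmul, ← add_assoc, ih, neg_one_zsmul,
      ← sub_eq_add_neg, sub_eq_iff_eq_add]
    ext
    · rw [int_add_turn]; simp only; ring
    · simp [frac_add]

theorem eq_lift_add (x : Cover h) : x = lift h x.frac + x.int • turn h := by
  rw [add_zsmul_turn]; simp [lift]

theorem exists_turn_of_frac_eq {x y : Cover h} (H : x.frac = y.frac) :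
    ∃ t : ℤ, x = y + t • turn h := by
  refine ⟨x.int - y.int, ?_⟩
  rw [add_zsmul_turn]
  ext <;> simp [H]

theorem int_zsmul_turn (n : ℤ) : (n • turn h).int = n := by
  rw [← zero_add (n • turn h), add_zsmul_turn]; simp [int_zero]

theorem turn_pos : 0 < turn h := by
  refine lt_of_le_of_ne (nonneg_iff.2 (by simp)) fun H => ?_
  simpa [int_zero] using congrArg int H

/-- So `int` is the floor in units of the turn. -/
theorem int_le_iff {x : Cover h} {n : ℤ} : n ≤ x.int ↔ n • turn h ≤ x := by
  have : x - n • turn h = x + (-n) • turn h := by rw [neg_zsmul, sub_eq_add_neg]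
  rw [← sub_nonneg (b := n • turn h), this, add_zsmul_turn, nonneg_iff]
  simp

theorem lift_nonneg (a : A) : 0 ≤ lift h a := nonneg_iff.2 (le_refl (0 : ℤ))

theorem lift_lt_turn (a : A) : lift h a < turn h := by
  by_contra hc
  rw [not_lt, ← one_zsmul (turn h), ← int_le_iff] at hc
  simp at hc

theorem eq_lift_of_mem {x : Cover h} (h0 : 0 ≤ x) (h1 : x < turn h) : lift h x.frac = x := by
  have e : ¬ 1 ≤ x.int := by rwa [int_le_iff, one_zsmul, not_le]
  rw [nonneg_iff] at h0
  ext
  · simp; omega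
  · rfl

theorem lift_lt_lift {a b : A} : lift h a < lift h b ↔ Cut O a b := by
  have key : ∀ {a b : A}, Cut O a b → lift h a ≤ lift h b := by
    intro a b H
    rw [← sub_nonneg, nonneg_iff, sub_eq_neg_add, int_add, int_neg, int_lift, int_lift, frac_neg,
      frac_lift, frac_lift, h.carry_neg]
    by_cases ha : a = 0
    · simpa [ha] using IsOrientation.carry_nonneg (O := O) _ _
    -- For a ≠ 0 the integer part of `-lift a` is -1, so the difference is nonnegative exactly
    -- because adding `b` produces a carry.
    · have : Cut O (-a + b) (-a) := by
        rw [h.cut_add_left_iff, neg_neg]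
        refine ⟨by simpa using ha, ?_, ?_⟩
        · rintro rfl; exact h.not_cut_zero _ H
        · rcases H with ⟨h1, -⟩ | H
          · exact absurd h1 ha
          · exact .inr H
      simp [ha, carry, this]
  constructor
  · intro H
    have hne : a ≠ b := by rintro rfl; exact lt_irrefl _ H
    exact (h.cut_total hne).resolve_right fun hc => absurd (key hc) (not_le.2 H)
  · intro H
    refine lt_of_le_of_ne (key H) fun he => ?_
    rw [lift_inj] at he
    subst he
    exact h.cut_irrefl _ H

theorem orient_iff {a b c : A} : O a b c ↔ (lift h a < lift h b ∧ lift h b < lift h c) ∨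
    (lift h b < lift h c ∧ lift h c < lift h a) ∨ (lift h c < lift h a ∧ lift h a < lift h b) := by
  simp only [lift_lt_lift]
  exact h.iff_cut

theorem lift_add_of_lt {a b : A} (H : lift h a + lift h b < turn h) :
    lift h (a + b) = lift h a + lift h b :=
  eq_lift_of_mem (x := lift h a + lift h b) (add_nonneg (lift_nonneg a) (lift_nonneg b)) H

theorem lift_add_of_le {a b : A} (H : turn h ≤ lift h a + lift h b) :
    lift h (a + b) = lift h a + lift h b - turn h := by
  have := eq_lift_of_mem (x := lift h a + lift h b - turn h) (sub_nonneg.2 H)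
    (by rw [sub_lt_iff_lt_add]; exact add_lt_add (lift_lt_turn a) (lift_lt_turn b))
  rw [frac_sub, frac_add] at this
  simpa using this

theorem lift_neg {a : A} (H : a ≠ 0) : lift h (-a) = turn h - lift h a := by
  have hp : 0 < lift h a := lt_of_le_of_ne (lift_nonneg a) fun H' => H (lift_injective H'.symm)
  have := eq_lift_of_mem (x := turn h - lift h a) (sub_nonneg.2 (lift_lt_turn a).le)
    (by rw [sub_lt_self_iff]; exact hp)
  rw [frac_sub] at this
  simpa using this

end Cover

end Cut

/-! ### Divisibility, density and torsion read in the cover. -/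

/-- An ordered abelian group with a distinguished positive element `u` such that every element is
divisible modulo multiples of `u`, and the multiples of every positive integer are dense. -/
structure IsRegularlyDenseTurn {G : Type w} [AddCommGroup G] [LinearOrder G] (u : G) : Prop where
  pos : 0 < u
  exists_add_zsmul : ∀ m : ℤ, 0 < m → ∀ x : G, ∃ (t : ℤ) (g : G), x + t • u = m • g
  exists_between : ∀ m : ℤ, 0 < m → ∀ x y : G, x < y → ∃ g : G, x < m • g ∧ m • g < y

/-- `A` with `O` is a nontrivial divisible regularly dense oriented abelian group such that
`e(A, p) = e p` for all primes `p`. -/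
structure IsDivisibleModel (e : Nat.Primes → ℕ∞) (A : Type w) [AddCommGroup A]
    (O : A → A → A → Prop) : Prop where
  nontrivial : Nontrivial A
  orientation : IsOrientation O
  regularlyDense : IsRegularlyDense O
  index_eq_one : ∀ p : Nat.Primes, (nsmulAddMonoidHom (α := A) p).range.index = 1
  torsionExponent_eq : ∀ p : Nat.Primes, torsionExponent A p = e p

namespace IsDivisibleModel

variable {e : Nat.Primes → ℕ∞} {A : Type w} [AddCommGroup A] {O : A → A → A → Prop}

theorem exists_zsmul_eq (hA : IsDivisibleModel e A O) {m : ℤ} (hm : 0 < m) (a : A) :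
    ∃ b : A, m • b = a := by
  have key : ∀ n : ℕ, 0 < n → ∀ a : A, ∃ b : A, n • b = a := by
    intro n
    induction n using induction_on_primes with
    | zero => simp
    | one => exact fun _ a => ⟨a, one_nsmul a⟩
    | prime_mul p k hp ih =>
      intro hpk a
      obtain ⟨b, hb⟩ := ih (Nat.pos_of_mul_pos_left hpk) a
      have h1 := hA.index_eq_one ⟨p, hp⟩
      rw [AddSubgroup.index_eq_one, AddSubgroup.eq_top_iff'] at h1
      obtain ⟨c, hc⟩ := h1 b
      refine ⟨c, ?_⟩
      rw [mul_comm, mul_nsmul, ← hb, ← hc]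
      simp [nsmul_left_comm]
  lift m to ℕ using hm.le
  obtain ⟨b, hb⟩ := key m (by exact_mod_cast hm) a
  exact ⟨b, by simpa using hb⟩

open Cover

theorem exists_add_zsmul_turn (hA : IsDivisibleModel e A O) {m : ℤ} (hm : 0 < m)
    (x : Cover hA.orientation) :
    ∃ (t : ℤ) (g : Cover hA.orientation), x + t • turn hA.orientation = m • g := by
  obtain ⟨b, hb⟩ := hA.exists_zsmul_eq hm x.frac
  obtain ⟨t, ht⟩ := exists_turn_of_frac_eq (x := m • lift hA.orientation b) (y := x)
    (by rw [frac_zsmul, frac_lift, hb])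
  exact ⟨t, _, ht.symm⟩

/-- The condition that c, 2c, ..., pc increase says that the multiples of `c` never pass a full
turn, so lifting commutes with multiplication by `p`. The result is regular density inside one turn;
`exists_prime_between` removes that restriction. -/
theorem exists_between_of_lt_turn (hA : IsDivisibleModel e A O) {p : ℕ} (hp : p.Prime)
    {x y : Cover hA.orientation} (hx : 0 < x) (hxy : x < y) (hy : y < turn hA.orientation) :
    ∃ g : Cover hA.orientation, x < p • g ∧ p • g < y := by
  have h := hA.orientation
  have ex := eq_lift_of_mem hx.le (hxy.trans hy)
  have ey := eq_lift_of_mem (hx.trans hxy).le hy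
  generalize x.frac = a at ex
  generalize y.frac = b at ey
  subst ex ey
  have hO : O 0 a b := by
    rcases lift_lt_lift.1 hxy with ⟨rfl, -⟩ | H
    · exact absurd hx (by simp)
    · exact H
  obtain ⟨c, hc, hc'⟩ := hA.regularlyDense p hp a b hO
  have key : ∀ i : ℕ, 1 ≤ i → i ≤ p → lift h (i • c) = i • lift h c := by
    intro i hi
    induction i, hi using Nat.le_induction with
    | base => simp
    | succ i hi ih =>
      intro hip
      have h1 := ih (by omega)
      have h2 : lift h (i • c) < lift h ((i + 1) • c) :=
        lift_lt_lift.2 (.inr (hc' i hi (by omega)).2)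
      rw [succ_nsmul, succ_nsmul, ← h1]
      rw [succ_nsmul] at h2
      rcases lt_or_ge (lift h (i • c) + lift h c) (turn h) with H | H
      · exact lift_add_of_lt H
      · rw [lift_add_of_le H, add_sub_assoc, lt_add_iff_pos_right, sub_pos] at h2
        exact absurd (lift_lt_turn c) (not_lt_of_gt h2)
  refine ⟨lift h c, ?_⟩
  rw [← key p hp.one_le le_rfl]
  rcases (orient_iff (h := h)).1 hc with H | H | H
  · exact H
  · exact absurd hxy (not_lt_of_gt H.2)
  · exact absurd hxy (not_lt_of_gt H.1)

/-- Below half a turn, an even element 2g strictly between x and 2x gives 0 < g < x. At exactly half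
a turn, u = 2x, so divisibility modulo u makes `x` itself even. Above it, u - x is smaller than `x`.
-/
theorem exists_pos_lt (hA : IsDivisibleModel e A O) {x : Cover hA.orientation} (hx : 0 < x) :
    ∃ y, 0 < y ∧ y < x := by
  have h := hA.orientation
  rcases le_or_gt (turn h) x with H | H
  · obtain ⟨a, ha⟩ := (nontrivial_iff_exists_ne (0 : A)).1 hA.nontrivial
    refine ⟨lift h a, lt_of_le_of_ne (lift_nonneg a) fun h0 => ha (lift_injective h0.symm),
      (lift_lt_turn a).trans_le H⟩
  rcases lt_trichotomy (x + x) (turn h) with H2 | H2 | H2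
  · obtain ⟨g, h1, h2⟩ := hA.exists_between_of_lt_turn Nat.prime_two hx
      (lt_add_of_pos_right x hx) H2
    rw [two_nsmul] at h1 h2
    refine ⟨g, ?_, ?_⟩
    · by_contra hg
      rw [not_lt] at hg
      exact absurd (hx.trans h1) (not_lt.2 (add_nonpos hg hg))
    · by_contra hg
      rw [not_lt] at hg
      exact absurd h2 (not_lt.2 (add_le_add hg hg))
  · obtain ⟨t, g, ht⟩ := hA.exists_add_zsmul_turn (m := 2) two_pos x
    have e1 : x = (2 : ℤ) • (g - t • x) := by
      rw [smul_sub, ← ht, ← H2, ← two_zsmul, smul_comm]; abel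
    rw [two_zsmul] at e1
    have hg : 0 < g - t • x := by
      by_contra hg
      rw [not_lt] at hg
      exact absurd hx (not_lt.2 (e1.le.trans (add_nonpos hg hg)))
    exact ⟨g - t • x, hg, by conv_rhs => rw [e1]
                             exact lt_add_of_pos_right _ hg⟩
  · exact ⟨turn h - x, sub_pos.2 H, by rwa [sub_lt_iff_lt_add]⟩

/-- Some x + tu lies in pG, but tu may be large. It is replaced by sε, where ε is a tiny positive
element congruent to u modulo p and s is congruent to t with 1 ≤ s ≤ p. -/
theorem exists_prime_between (hA : IsDivisibleModel e A O) {p : ℕ} (hp : p.Prime)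
    {x y : Cover hA.orientation} (hxy : x < y) :
    ∃ g : Cover hA.orientation, x < p • g ∧ p • g < y := by
  have h := hA.orientation
  have hp0 : 0 < p := hp.pos
  have hδ : 0 < min (y - x) (turn h) := lt_min (sub_pos.2 hxy) turn_pos
  obtain ⟨b, hb0, hb⟩ := hA.exists_pos_lt hδ
  obtain ⟨a, ha0, ha⟩ := hA.exists_pos_lt hb0
  obtain ⟨c, hc0, hc⟩ := hA.exists_between_of_lt_turn hp ha0 ha (hb.trans_le (min_le_right _ _))
  have hcpos : 0 < c := by
    by_contra hcn
    rw [not_lt] at hcn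
    exact absurd (ha0.trans hc0) (not_lt.2 (nsmul_nonpos hcn p))
  have hcu : c < turn h := by
    refine lt_of_le_of_lt ?_ (hc.trans (hb.trans_le (min_le_right _ _)))
    simpa using nsmul_le_nsmul_left hcpos.le hp0
  -- Density is so far available only strictly below the turn, so the interval for `p • f` has to
  -- end at turn - c' rather than at the turn.
  obtain ⟨c', hc'0, hc'⟩ := hA.exists_pos_lt hcpos
  obtain ⟨f, hf0, hf⟩ := hA.exists_between_of_lt_turn hp (x := turn h - c) (y := turn h - c')
    (sub_pos.2 hcu) (sub_lt_sub_left hc' _) (sub_lt_self _ hc'0)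
  obtain ⟨t, g, ht⟩ := hA.exists_add_zsmul_turn (m := p) (by exact_mod_cast hp0) x
  -- `turn - p • f` is small and congruent to the full turn modulo `p`
  set ε := turn h - p • f with hε
  have hε0 : 0 < ε := by rw [hε, sub_pos]; exact hf.trans (sub_lt_self _ hc'0)
  have hεc : ε < c := by rwa [hε, sub_lt_comm]
  -- The representative of `t` in 1, ..., p rather than 0, ..., p - 1, so that x + sε is strictly
  -- above `x`.
  set s : ℤ := (t - 1) % p + 1 with hs
  have hs0 : 1 ≤ s := by have := Int.emod_nonneg (t - 1) (b := p) (by omega); omega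
  have hsp : s ≤ p := by have := Int.emod_lt_of_pos (t - 1) (b := p) (by omega); omega
  obtain ⟨q, hq⟩ : ∃ q : ℤ, s = t - p * q := ⟨(t - 1) / p, by
    have := Int.emod_add_mul_ediv (t - 1) p; omega⟩
  have hsum : x + s • ε = p • (g - q • turn h - s • f) := by
    rw [hε, eq_sub_of_add_eq ht, smul_sub]
    have e1 : s • turn h = t • turn h - p • (q • turn h) := by
      rw [hq]; module
    rw [e1, smul_sub, smul_sub, natCast_zsmul, smul_comm s p f]
    abel
  refine ⟨_, hsum ▸ lt_add_of_pos_right x (zsmul_pos hε0 (by omega)), hsum ▸ ?_⟩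
  have h1 : s • ε ≤ (p : ℤ) • ε := zsmul_le_zsmul_left hε0.le hsp
  have h2 : (p : ℤ) • ε ≤ p • c := by rw [natCast_zsmul]; exact nsmul_le_nsmul_right hεc.le p
  have h3 : s • ε < y - x :=
    (h1.trans h2).trans_lt ((hc.trans hb).trans_le (min_le_left _ _))
  rwa [lt_sub_iff_add_lt, add_comm] at h3

theorem isRegularlyDenseTurn (hA : IsDivisibleModel e A O) :
    IsRegularlyDenseTurn (turn hA.orientation) where
  pos := turn_pos
  exists_add_zsmul _ hm := hA.exists_add_zsmul_turn hm
  exists_between := by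
    have key : ∀ n : ℕ, 0 < n → ∀ x y : Cover hA.orientation, x < y →
        ∃ g : Cover hA.orientation, x < n • g ∧ n • g < y := by
      intro n
      induction n using induction_on_primes with
      | zero => simp
      | one =>
        intro _ x y hxy
        obtain ⟨d, hd0, hd⟩ := hA.exists_pos_lt (sub_pos.2 hxy)
        exact ⟨x + d, by simpa using hd0, by rw [one_nsmul]; exact lt_sub_iff_add_lt'.1 hd⟩
      | prime_mul p k hp ih =>
        intro hpk x y hxy
        -- Two multiples pf < pf' inside the interval reduce the claim for pk to the claim for k
        -- between `f` and `f'`.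
        obtain ⟨f, hf, hf'⟩ := hA.exists_prime_between hp hxy
        obtain ⟨f', hf1, hf2⟩ := hA.exists_prime_between hp hf'
        obtain ⟨g, hg, hg'⟩ := ih (Nat.pos_of_mul_pos_left hpk) f f' (lt_of_nsmul_lt_nsmul_right p hf1)
        refine ⟨g, ?_, ?_⟩
        · rw [mul_comm, mul_nsmul]
          exact hf.trans_le (nsmul_le_nsmul_right hg.le p)
        · rw [mul_comm, mul_nsmul]
          exact (nsmul_le_nsmul_right hg'.le p).trans_lt hf2
    intro m hm x y hxy
    lift m to ℕ using hm.le
    simpa using key m (by exact_mod_cast hm) x y hxy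

/-- If u = pg, then `g.frac` is `p`-torsion, and it is nonzero since otherwise g = ju with pj = 1.
Conversely, a nonzero `p`-torsion element `x` has p · lift x = ju with 0 < j < p, and Bézout for p
and j puts u into pG. -/
theorem turn_eq_prime_smul_iff (hA : IsDivisibleModel e A O) (he : ∀ p, e p = 0 ∨ e p = ⊤)
    (p : Nat.Primes) :
    (∃ g : Cover hA.orientation, turn hA.orientation = (p : ℕ) • g) ↔ e p = ⊤ := by
  have h := hA.orientation
  obtain ⟨h1, h2⟩ := (torsionExponent_eq_iff p (e p)).1 (hA.torsionExponent_eq p)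
  constructor
  · rintro ⟨g, hg⟩
    refine (he p).resolve_left fun h0 => ?_
    have h3 := h2 0 (by simp [h0]) g.frac
    have h4 : (p : ℕ) • g.frac = 0 := by
      have := congrArg Cover.frac hg
      rw [← natCast_zsmul, frac_zsmul] at this
      simpa using this.symm
    have h5 : g.frac = 0 := by simpa [h4] using h3
    rw [eq_lift_add g, h5, lift_zero, zero_add, ← natCast_zsmul, ← mul_zsmul'] at hg
    have h6 := congrArg Cover.int hg
    rw [int_zsmul_turn, int_turn] at h6
    have h7 : (p : ℤ) ∣ 1 := by rw [h6]; simp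
    have := Int.le_of_dvd one_pos h7
    have := p.2.two_le
    omega
  · intro ht
    have h3 := h1 0 (by simp [ht])
    push Not at h3
    obtain ⟨x, hx, hx0⟩ := h3
    rw [zero_add, pow_one] at hx
    rw [pow_zero, one_nsmul] at hx0
    have e0 : ((p : ℤ) • lift h x).frac = 0 := by rw [frac_zsmul]; simpa using hx
    have e1 := eq_lift_add ((p : ℤ) • lift h x)
    rw [e0, lift_zero, zero_add] at e1
    set j := ((p : ℤ) • lift h x).int
    have hxpos : 0 < lift h x := lt_of_le_of_ne (lift_nonneg x) fun H => hx0 (lift_injective H.symm)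
    have hp0 : (0 : ℤ) < p := by exact_mod_cast p.2.pos
    have hj0 : 0 < j := by
      have : (0 : ℤ) • turn h < j • turn h := by
        rw [zero_smul, ← e1]; exact zsmul_pos hxpos hp0
      exact (zsmul_lt_zsmul_iff_left turn_pos).1 this
    have hjp : j < p := by
      have : j • turn h < (p : ℤ) • turn h := by
        rw [← e1]; exact zsmul_lt_zsmul_right hp0 (lift_lt_turn x)
      exact (zsmul_lt_zsmul_iff_left turn_pos).1 this
    have hcop : IsCoprime (p : ℤ) j := by
      refine (Prime.coprime_iff_not_dvd (Nat.prime_iff_prime_int.1 p.2)).2 fun hd => ?_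
      exact absurd (Int.le_of_dvd hj0 hd) (not_le.2 hjp)
    obtain ⟨a, b, hab⟩ := hcop
    refine ⟨a • turn h + b • lift h x, ?_⟩
    rw [← natCast_zsmul, smul_add, smul_comm _ b, e1, ← mul_zsmul', ← mul_zsmul, ← add_zsmul, hab,
      one_zsmul]

/-- Which ku lie in mG depends on `e` only; the prime factors p of m are removed one by one. If u is
in pG, then all of G is p-divisible and the factor costs nothing. If not, Bézout forces p to divide
k, and p cancels because G is torsion-free. -/
theorem zsmul_turn_eq_smul (he : ∀ p, e p = 0 ∨ e p = ⊤) (hA : IsDivisibleModel e A O)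
    {A' : Type v} [AddCommGroup A'] {O' : A' → A' → A' → Prop} (hA' : IsDivisibleModel e A' O')
    {m : ℤ} (hm : 0 < m) {k : ℤ} (H : ∃ g, k • turn hA.orientation = m • g) :
    ∃ g, k • turn hA'.orientation = m • g := by
  have key : ∀ n : ℕ, 0 < n → ∀ k : ℤ, (∃ g, k • turn hA.orientation = n • g) →
      ∃ g, k • turn hA'.orientation = n • g := by
    intro n
    induction n using induction_on_primes with
    | zero => simp
    | one => intro _ k _; exact ⟨_, (one_nsmul _).symm⟩
    | prime_mul p n hp ih =>
      rintro hpn k ⟨g, hg⟩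
      have hn := Nat.pos_of_mul_pos_left hpn
      by_cases hu : ∃ g, turn hA.orientation = p • g
      · rw [hA.turn_eq_prime_smul_iff he ⟨p, hp⟩, ← hA'.turn_eq_prime_smul_iff he ⟨p, hp⟩] at hu
        obtain ⟨f, hf⟩ := hu
        obtain ⟨g', hg'⟩ := ih hn k ⟨p • g, by rw [hg, mul_nsmul]⟩
        obtain ⟨t, f', hf'⟩ := hA'.exists_add_zsmul_turn (m := p) (by exact_mod_cast hp.pos) g'
        refine ⟨f' - t • f, ?_⟩
        have : g' = p • (f' - t • f) := by
          rw [eq_sub_of_add_eq hf', hf, smul_sub, natCast_zsmul, smul_comm]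
        rw [hg', mul_nsmul, ← this]
      · obtain ⟨j, rfl⟩ : (p : ℤ) ∣ k := by
          by_contra hk
          obtain ⟨a, b, hab⟩ := (Prime.coprime_iff_not_dvd (Nat.prime_iff_prime_int.1 hp)).2 hk
          apply hu
          refine ⟨a • turn hA.orientation + b • (n • g), ?_⟩
          rw [smul_add, smul_comm _ b, ← mul_nsmul', ← hg, ← natCast_zsmul, ← mul_zsmul', ← mul_zsmul,
            ← add_zsmul, hab, one_zsmul]
        have hj : j • turn hA.orientation = n • g := by
          rw [mul_zsmul, natCast_zsmul, mul_nsmul'] at hg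
          exact nsmul_right_injective hp.ne_zero hg
        obtain ⟨g', hg'⟩ := ih hn j ⟨g, hj⟩
        exact ⟨g', by rw [mul_zsmul, natCast_zsmul, mul_nsmul', hg']⟩
  lift m to ℕ using hm.le
  simp only [natCast_zsmul] at H ⊢
  exact key m (by exact_mod_cast hm) k H

end IsDivisibleModel

/-! ### Integral affine forms, similar tuples and the one-point extension. -/

section CoeffBound

variable {ι : Type}

/-- The coefficients of an affine form are bounded by `B`. -/
def CoeffBound (B : ℤ) (k : ι → ℤ) (m : ℤ) : Prop := (∀ i, |k i| ≤ B) ∧ |m| ≤ B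

theorem CoeffBound.mono {B B' : ℤ} (hB : B ≤ B') {k : ι → ℤ} {m : ℤ} (h : CoeffBound B k m) :
    CoeffBound B' k m :=
  ⟨fun i => (h.1 i).trans hB, h.2.trans hB⟩

theorem CoeffBound.smul {B : ℤ} {k : ι → ℤ} {m : ℤ} (h : CoeffBound B k m) {q Q : ℤ}
    (hq : |q| ≤ Q) : CoeffBound (Q * B) (q • k) (q * m) := by
  have hQ : 0 ≤ Q := (abs_nonneg q).trans hq
  refine ⟨fun i => ?_, ?_⟩
  · rw [Pi.smul_apply, smul_eq_mul, abs_mul]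
    exact mul_le_mul hq (h.1 i) (abs_nonneg _) hQ
  · rw [abs_mul]
    exact mul_le_mul hq h.2 (abs_nonneg _) hQ

theorem CoeffBound.sub {B : ℤ} {k k' : ι → ℤ} {m m' : ℤ} (h : CoeffBound B k m)
    (h' : CoeffBound B k' m') : CoeffBound (2 * B) (k - k') (m - m') := by
  refine ⟨fun i => ?_, ?_⟩
  · have := abs_sub (k i) (k' i)
    have := h.1 i
    have := h'.1 i
    simp only [Pi.sub_apply]
    linarith
  · have := abs_sub m m'
    have := h.2
    have := h'.2
    linarith

end CoeffBound

section Scaling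

variable {G : Type v} [AddCommGroup G] [LinearOrder G] [IsOrderedAddMonoid G]

theorem nonneg_zsmul_iff {q : ℤ} (hq : 0 < q) {z : G} : 0 ≤ q • z ↔ 0 ≤ z := by
  conv_lhs => rw [← smul_zero q]
  exact zsmul_le_zsmul_iff_right hq

/-- Scaling by `q` brings every coefficient of `z` to the common value `L`, so that only the
position of `L • z` matters. -/
theorem nonneg_smul_add_iff_le_smul {L k q : ℤ} (hL : L = -k * q) (hq : 0 < q) {z s : G} :
    0 ≤ k • z + s ↔ L • z ≤ q • s := by
  rw [← nonneg_zsmul_iff hq, ← sub_nonneg (b := L • z), hL]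
  have : q • (k • z + s) = q • s - (-k * q) • z := by module
  rw [this]

theorem nonneg_smul_add_iff_smul_le {L k q : ℤ} (hL : L = k * q) (hq : 0 < q) {z s : G} :
    0 ≤ k • z + s ↔ (-q) • s ≤ L • z := by
  rw [← nonneg_zsmul_iff hq, ← sub_nonneg (a := L • z), hL]
  have : q • (k • z + s) = (k * q) • z - (-q) • s := by module
  rw [this]

end Scaling

section Similarity

variable {G : Type v} [AddCommGroup G] {H : Type w} [AddCommGroup H] {ι : Type} [Fintype ι]

/-- The value at `x` of the integral affine form with linear coefficients `k` and constant
coefficient `m`, in units of `u`. -/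
def affineForm (u : G) (k : ι → ℤ) (m : ℤ) (x : ι → G) : G := ∑ i, k i • x i + m • u

theorem affineForm_smul (u : G) (k : ι → ℤ) (m q : ℤ) (x : ι → G) :
    affineForm u (q • k) (q * m) x = q • affineForm u k m x := by
  simp [affineForm, mul_smul, Finset.smul_sum]

theorem affineForm_sub (u : G) (k k' : ι → ℤ) (m m' : ℤ) (x : ι → G) :
    affineForm u (k - k') (m - m') x = affineForm u k m x - affineForm u k' m' x := by
  simp [affineForm, sub_smul]
  abel

theorem affineForm_zero (u : G) (m : ℤ) (x : ι → G) : affineForm u 0 m x = m • u := by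
  simp [affineForm]

theorem coeffBound_finite (B : ℤ) : {p : (ι → ℤ) × ℤ | CoeffBound B p.1 p.2}.Finite := by
  classical
  refine (Finset.finite_toSet ((Fintype.piFinset fun _ : ι => Finset.Icc (-B) B) ×ˢ
    Finset.Icc (-B) B)).subset fun p hp => ?_
  simp only [Finset.coe_product, Set.mem_prod, SetLike.mem_coe, Fintype.mem_piFinset, Finset.mem_Icc,
    ← abs_le]
  exact hp

/-- `x` and `y` have a common residue modulo `M`, relative to `u` and `u'`. -/
def SameResidue (u : G) (u' : H) (M : ℤ) (x : G) (y : H) : Prop :=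
  ∃ t : ℤ, (∃ g, x + t • u = M • g) ∧ ∃ h, y + t • u' = M • h

theorem SameResidue.of_dvd {u : G} {u' : H} {M M' : ℤ} (hM : M ∣ M') {x : G} {y : H}
    (h : SameResidue u u' M' x y) : SameResidue u u' M x y := by
  obtain ⟨q, rfl⟩ := hM
  obtain ⟨t, ⟨g, hg⟩, g', hg'⟩ := h
  exact ⟨t, ⟨q • g, by rw [hg, mul_zsmul]⟩, q • g', by rw [hg', mul_zsmul]⟩

theorem sameResidue_affineForm {u : G} {u' : H} {M : ℤ} {x : ι → G} {y : ι → H}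
    (h : ∀ i, SameResidue u u' M (x i) (y i)) (k : ι → ℤ) (m : ℤ) :
    SameResidue u u' M (affineForm u k m x) (affineForm u' k m y) := by
  choose t ht ht' using h
  choose g hg using ht
  choose g' hg' using ht'
  refine ⟨∑ i, k i * t i - m, ⟨∑ i, k i • g i, ?_⟩, ⟨∑ i, k i • g' i, ?_⟩⟩
  · simp only [affineForm, sub_smul, Finset.sum_smul, Finset.smul_sum, smul_comm M, ← hg, smul_add,
      mul_smul, Finset.sum_add_distrib]
    abel
  · simp only [affineForm, sub_smul, Finset.sum_smul, Finset.smul_sum, smul_comm M, ← hg', smul_add,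
      mul_smul, Finset.sum_add_distrib]
    abel

variable [LinearOrder G] [LinearOrder H]

/-- The tuples `x` and `y` give the same signs to all affine forms with coefficients bounded by `B`,
and their entries have common residues modulo `M`. -/
structure Similar (u : G) (u' : H) (B M : ℤ) (x : ι → G) (y : ι → H) : Prop where
  nonneg_iff : ∀ k m, CoeffBound B k m → (0 ≤ affineForm u k m x ↔ 0 ≤ affineForm u' k m y)
  sameResidue : ∀ i, SameResidue u u' M (x i) (y i)

namespace Similar

variable {u : G} {u' : H} {B M : ℤ} {x : ι → G} {y : ι → H}

theorem mono {B' M' : ℤ} (h : Similar u u' B' M' x y) (hB : B ≤ B') (hM : M ∣ M') :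
    Similar u u' B M x y :=
  ⟨fun k m hk => h.nonneg_iff k m (hk.mono hB), fun i => (h.sameResidue i).of_dvd hM⟩

variable [IsOrderedAddMonoid G] [IsOrderedAddMonoid H]

theorem le_iff (h : Similar u u' (2 * B) M x y) {k k' : ι → ℤ} {m m' : ℤ} (hk : CoeffBound B k m)
    (hk' : CoeffBound B k' m') : affineForm u k m x ≤ affineForm u k' m' x ↔
      affineForm u' k m y ≤ affineForm u' k' m' y := by
  rw [← sub_nonneg, ← affineForm_sub, ← sub_nonneg (b := affineForm u' k m y), ← affineForm_sub]
  exact h.nonneg_iff _ _ (hk'.sub hk)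

theorem lt_iff (h : Similar u u' (2 * B) M x y) {k k' : ι → ℤ} {m m' : ℤ} (hk : CoeffBound B k m)
    (hk' : CoeffBound B k' m') : affineForm u k m x < affineForm u k' m' x ↔
      affineForm u' k m y < affineForm u' k' m' y := by
  rw [← not_le, ← not_le, h.le_iff hk' hk]

end Similar

/-- If `L • c` and `L • d` have the same position with respect to the affine forms in `x` and `y`
with coefficients bounded by `L * B`, then the affine forms in `c, x` and in `d, y` with coefficients
bounded by `B` have the same signs. -/
theorem nonneg_smul_add_affineForm_iff [IsOrderedAddMonoid G] [IsOrderedAddMonoid H]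
    {u : G} {u' : H} {B L : ℤ} {x : ι → G} {y : ι → H} (hL : 0 < L)
    (hdvd : ∀ k : ℤ, 0 < k → k ≤ B → k ∣ L)
    (hxy : ∀ k m, CoeffBound B k m → (0 ≤ affineForm u k m x ↔ 0 ≤ affineForm u' k m y))
    {c : G} {d : H}
    (hle : ∀ k m, CoeffBound (L * B) k m →
      (affineForm u k m x ≤ L • c ↔ affineForm u' k m y ≤ L • d))
    (hge : ∀ k m, CoeffBound (L * B) k m →
      (L • c ≤ affineForm u k m x ↔ L • d ≤ affineForm u' k m y))
    {k₀ : ℤ} (hk₀ : |k₀| ≤ B) {k : ι → ℤ} {m : ℤ} (hk : CoeffBound B k m) :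
    0 ≤ k₀ • c + affineForm u k m x ↔ 0 ≤ k₀ • d + affineForm u' k m y := by
  have hB : 0 ≤ B := (abs_nonneg _).trans hk₀
  rcases lt_trichotomy k₀ 0 with h | rfl | h
  · obtain ⟨q, hq⟩ := hdvd (-k₀) (by omega) (by rwa [abs_of_neg h] at hk₀)
    have hq0 : 0 < q := by
      rcases lt_or_ge 0 q with h0 | h0
      · exact h0
      · nlinarith
    have hqL : |q| ≤ L := by rw [abs_of_pos hq0]; nlinarith
    rw [nonneg_smul_add_iff_le_smul hq hq0, nonneg_smul_add_iff_le_smul hq hq0, ← affineForm_smul,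
      ← affineForm_smul]
    exact hge _ _ (hk.smul hqL)
  · simpa using hxy k m hk
  · obtain ⟨q, hq⟩ := hdvd k₀ h (by rwa [abs_of_pos h] at hk₀)
    have hq0 : 0 < q := by
      rcases lt_or_ge 0 q with h0 | h0
      · exact h0
      · nlinarith
    have hqL : |(-q)| ≤ L := by rw [abs_neg, abs_of_pos hq0]; nlinarith
    rw [nonneg_smul_add_iff_smul_le hq hq0, nonneg_smul_add_iff_smul_le hq hq0, ← affineForm_smul,
      ← affineForm_smul]
    exact hle _ _ (hk.smul hqL)

variable [IsOrderedAddMonoid G] [IsOrderedAddMonoid H] {u : G} {u' : H}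

/-- Density of the multiples of LM, applied to the interval shifted by Ltu', yields LMg; then d = Mg
- tu' has the prescribed residue. -/
theorem IsRegularlyDenseTurn.exists_residue_between (hu' : IsRegularlyDenseTurn u') {L M : ℤ} (hL : 0 < L)
    (hM : 0 < M) {s s' : H} (hs : s < s') (t : ℤ) :
    ∃ d : H, s < L • d ∧ L • d < s' ∧ ∃ h, d + t • u' = M • h := by
  obtain ⟨g, hg, hg'⟩ := hu'.exists_between (L * M) (mul_pos hL hM) (s + (L * t) • u')
    (s' + (L * t) • u') (by simpa using hs)
  refine ⟨M • g - t • u', ?_, ?_, g, by simp⟩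
  · rw [smul_sub, ← mul_smul, ← mul_smul, lt_sub_iff_add_lt]; exact hg
  · rw [smul_sub, ← mul_smul, ← mul_smul, sub_lt_iff_lt_add]; exact hg'

/-- The back-and-forth step. The bound 2LB is needed because comparing two forms bounded by LB means
taking the sign of their difference. The modulus LM is needed because, when Lc is a form, its
counterpart must be divided by L and still have the right residue modulo M. -/
theorem Similar.exists_extension (hu : IsRegularlyDenseTurn u) (hu' : IsRegularlyDenseTurn u')
    (huu' : ∀ m : ℤ, 0 < m → ∀ k : ℤ, (∃ g, k • u = m • g) → ∃ g, k • u' = m • g)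
    {B L M : ℤ} (hB : 1 ≤ B) (hL : 0 < L) (hM : 0 < M)
    (hdvd : ∀ k : ℤ, 0 < k → k ≤ B → k ∣ L) {x : ι → G} {y : ι → H}
    (h : Similar u u' (2 * (L * B)) (L * M) x y) {c : G} (hc : 0 ≤ c) (hcu : c < u) :
    ∃ d, 0 ≤ d ∧ d < u' ∧ SameResidue u u' M c d ∧
      ∀ k₀ k m, |k₀| ≤ B → CoeffBound B k m →
        (0 ≤ k₀ • c + affineForm u k m x ↔ 0 ≤ k₀ • d + affineForm u' k m y) := by
  have hLB : L ≤ L * B := by nlinarith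
  have b0 : CoeffBound (ι := ι) (L * B) 0 0 := ⟨fun i => by simp; omega, by simp; omega⟩
  have bL : CoeffBound (ι := ι) (L * B) 0 L := ⟨fun i => by simp; omega, by rwa [abs_of_pos hL]⟩
  have bneg : CoeffBound (ι := ι) (L * B) 0 (-1) := ⟨fun i => by simp; omega, by simp; omega⟩
  -- it is enough to put `L • d` into the right cut
  suffices H : ∃ d, SameResidue u u' M c d ∧ ∀ k m, CoeffBound (L * B) k m →
      ((affineForm u k m x ≤ L • c ↔ affineForm u' k m y ≤ L • d) ∧
        (L • c ≤ affineForm u k m x ↔ L • d ≤ affineForm u' k m y)) by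
    obtain ⟨d, hd, hk⟩ := H
    refine ⟨d, ?_, ?_, hd, fun k₀ k m hk₀ hkm =>
      nonneg_smul_add_affineForm_iff hL hdvd (fun k m hkm => h.nonneg_iff k m (hkm.mono (by nlinarith)))
        (fun k m hkm => (hk k m hkm).1) (fun k m hkm => (hk k m hkm).2) hk₀ hkm⟩
    · have := (hk 0 0 b0).1
      rw [affineForm_zero, affineForm_zero, zero_smul, zero_smul] at this
      exact (nonneg_zsmul_iff hL).1 (this.1 (zsmul_nonneg hc hL.le))
    · have := (hk 0 L bL).1
      rw [affineForm_zero, affineForm_zero, zsmul_le_zsmul_iff_right hL, zsmul_le_zsmul_iff_right hL] at this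
      rw [← not_le] at hcu ⊢
      rwa [← this]
  by_cases hex : ∃ k m, CoeffBound (L * B) k m ∧ affineForm u k m x = L • c
  · obtain ⟨k, m, hkm, hkc⟩ := hex
    obtain ⟨t, g, ht⟩ := hu.exists_add_zsmul M hM c
    obtain ⟨r, ⟨g₁, hg₁⟩, g₂, hg₂⟩ := sameResidue_affineForm h.sameResidue k m
    -- Here `r` is a residue of the form modulo LM and `t` one of c modulo M. Since the form is Lc,
    -- (r - Lt)u lies in LMG, a fact that transfers to u' and corrects the witness.
    obtain ⟨g₃, hg₃⟩ := huu' (L * M) (mul_pos hL hM) (r - L * t) ⟨g₁ - g, by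
      rw [smul_sub, ← hg₁, hkc, mul_smul, ← ht]; module⟩
    have hd : affineForm u' k m y = L • (M • (g₂ - g₃) - t • u') := by
      rw [eq_sub_of_add_eq hg₂]
      have : L • (M • (g₂ - g₃) - t • u') = (L * M) • g₂ - (L * M) • g₃ - (L * t) • u' := by module
      rw [this, ← hg₃]; module
    refine ⟨M • (g₂ - g₃) - t • u', ⟨t, ⟨g, ht⟩, g₂ - g₃, by simp⟩, fun k' m' hkm' => ?_⟩
    rw [← hd, ← hkc]
    exact ⟨h.le_iff hkm' hkm, h.le_iff hkm hkm'⟩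
  · push Not at hex
    have fin := coeffBound_finite (ι := ι) (L * B)
    -- The nearest forms below and above `L • c` exist: there are finitely many forms, and 0 ≤ c < u
    -- puts -u below and Lu above.
    obtain ⟨p, ⟨hpB, hpc⟩, hpmax⟩ := Set.exists_max_image
      {p : (ι → ℤ) × ℤ | CoeffBound (L * B) p.1 p.2 ∧ affineForm u p.1 p.2 x < L • c}
      (fun p => affineForm u p.1 p.2 x) (fin.subset fun p hp => hp.1) ⟨(0, -1), bneg, by
        rw [affineForm_zero, neg_smul, one_smul]
        exact (neg_neg_of_pos hu.pos).trans_le (zsmul_nonneg hc hL.le)⟩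
    obtain ⟨p', ⟨hpB', hpc'⟩, hpmin⟩ := Set.exists_min_image
      {p : (ι → ℤ) × ℤ | CoeffBound (L * B) p.1 p.2 ∧ L • c < affineForm u p.1 p.2 x}
      (fun p => affineForm u p.1 p.2 x) (fin.subset fun p hp => hp.1) ⟨(0, L), bL, by
        rw [affineForm_zero]; exact zsmul_lt_zsmul_right hL hcu⟩
    have hlt := (h.lt_iff hpB hpB').1 (hpc.trans hpc')
    obtain ⟨t, g, ht⟩ := hu.exists_add_zsmul M hM c
    obtain ⟨d, hd, hd', hdt⟩ := hu'.exists_residue_between hL hM hlt t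
    refine ⟨d, ⟨t, ⟨g, ht⟩, hdt⟩, fun k m hkm => ?_⟩
    rcases lt_or_gt_of_ne (hex k m hkm) with hlt | hgt
    · have h1 := ((h.le_iff hkm hpB).1 (hpmax (k, m) ⟨hkm, hlt⟩)).trans_lt hd
      exact ⟨iff_of_true hlt.le h1.le, iff_of_false (not_le.2 hlt) (not_le.2 h1)⟩
    · have h1 := hd'.trans_le ((h.le_iff hpB' hkm).1 (hpmin (k, m) ⟨hkm, hgt⟩))
      exact ⟨iff_of_false (not_le.2 hgt) (not_le.2 h1), iff_of_true hgt.le h1.le⟩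

end Similarity

open Cover

/-! ### Truth of formulas at similar tuples. -/

section Formulas

theorem SameResidue.symm {G : Type v} [AddCommGroup G] {H : Type w} [AddCommGroup H] {u : G} {u' : H}
    {M : ℤ} {x : G} {y : H} (h : SameResidue u u' M x y) : SameResidue u' u M y x :=
  let ⟨t, ht, ht'⟩ := h
  ⟨t, ht', ht⟩

theorem Similar.symm {G : Type v} [AddCommGroup G] {H : Type w} [AddCommGroup H] {ι : Type}
    [Fintype ι] [LinearOrder G] [LinearOrder H] {u : G} {u' : H} {B M : ℤ} {x : ι → G} {y : ι → H}
    (h : Similar u u' B M x y) : Similar u' u B M y x :=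
  ⟨fun k m hk => (h.nonneg_iff k m hk).symm, fun i => (h.sameResidue i).symm⟩

variable {A : Type w} [AddCommGroup A] {O : A → A → A → Prop} (h : IsOrientation O)
variable {A' : Type w} [AddCommGroup A'] {O' : A' → A' → A' → Prop} (h' : IsOrientation O')

/-- The lifts of the tuples `x` and `y` to the covers are similar. -/
abbrev SimilarTuple {ι : Type} [Fintype ι] (B M : ℤ) (x : ι → A) (y : ι → A') : Prop :=
  Similar (turn h) (turn h') B M (lift h ∘ x) (lift h' ∘ y)

/-- The affine form with coefficients `k`, `m` takes the lift of `a` as its value at `x`. -/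
def IsLiftForm {ι : Type} [Fintype ι] (k : ι → ℤ) (m : ℤ) (x : ι → A) (a : A) : Prop :=
  lift h a = affineForm (turn h) k m (lift h ∘ x)

theorem affineForm_add {G : Type v} [AddCommGroup G] {ι : Type} [Fintype ι] (u : G) (k k' : ι → ℤ)
    (m m' : ℤ) (x : ι → G) :
    affineForm u (k + k') (m + m') x = affineForm u k m x + affineForm u k' m' x := by
  simp only [affineForm, Pi.add_apply, add_smul, Finset.sum_add_distrib]
  abel

theorem affineForm_sub_smul {G : Type v} [AddCommGroup G] {ι : Type} [Fintype ι] (u : G) (k : ι → ℤ)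
    (m m' : ℤ) (x : ι → G) :
    affineForm u k (m - m') x = affineForm u k m x - m' • u := by
  simp only [affineForm, sub_smul, add_sub_assoc]

theorem affineForm_neg {G : Type v} [AddCommGroup G] {ι : Type} [Fintype ι] (u : G) (k : ι → ℤ)
    (m : ℤ) (x : ι → G) :
    affineForm u (-k) (-m) x = - affineForm u k m x := by
  simpa using affineForm_smul u k m (-1) x

theorem CoeffBound.add {ι : Type} {B B' : ℤ} {k k' : ι → ℤ} {m m' : ℤ} (hk : CoeffBound B k m)
    (hk' : CoeffBound B' k' m') : CoeffBound (B + B') (k + k') (m + m') :=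
  ⟨fun i => (abs_add_le _ _).trans (add_le_add (hk.1 i) (hk'.1 i)),
    (abs_add_le _ _).trans (add_le_add hk.2 hk'.2)⟩

theorem CoeffBound.sub_right {ι : Type} {B : ℤ} {k : ι → ℤ} {m : ℤ} (hk : CoeffBound B k m) :
    CoeffBound (B + 1) k (m - 1) :=
  ⟨fun i => (hk.1 i).trans (by omega), (abs_sub _ _).trans (add_le_add hk.2 (by simp))⟩

theorem CoeffBound.neg {ι : Type} {B : ℤ} {k : ι → ℤ} {m : ℤ} (hk : CoeffBound B k m) :
    CoeffBound B (-k) (-m) :=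
  ⟨fun i => by simpa using hk.1 i, by simpa using hk.2⟩

theorem lift_add_cases (a b : A) :
    lift h (a + b) = if 0 ≤ lift h a + lift h b - turn h then lift h a + lift h b - turn h
      else lift h a + lift h b := by
  split_ifs with H
  · exact lift_add_of_le (sub_nonneg.1 H)
  · exact lift_add_of_lt (sub_neg.1 (not_le.1 H))

theorem lift_neg_cases (a : A) :
    lift h (-a) = if 0 ≤ - lift h a then 0 else - (lift h a - turn h) := by
  split_ifs with H
  · have : lift h a = lift h 0 := le_antisymm (by simpa using H) (lift_nonneg a)
    rw [lift_inj.1 this]; simp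
  · rw [lift_neg, neg_sub]
    rintro rfl
    simp at H

/-- The lift of a term is an affine form in the lifts of the variables, but which form depends on
where sums overflow. Those tests are signs of bounded forms, so similar tuples pass through the same
branches and share the form. Each operation may remove one turn, whence the + 1 in the bounds. -/
theorem exists_isLiftForm_realize {ι : Type} [Fintype ι] (t : langO.Term ι) :
    ∃ C : ℤ, 0 ≤ C ∧ ∀ (M : ℤ) {A : Type w} [AddCommGroup A] {O : A → A → A → Prop}
      (h : IsOrientation O) {A' : Type w} [AddCommGroup A'] {O' : A' → A' → A' → Prop}
      (h' : IsOrientation O') (x : ι → A) (y : ι → A'), SimilarTuple h h' C M x y →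
      ∃ k m, CoeffBound C k m ∧
        IsLiftForm h k m x (letI := toStructure A O; t.realize x) ∧
        IsLiftForm h' k m y (letI := toStructure A' O'; t.realize y) := by
  classical
  induction t with
  | var i =>
    refine ⟨1, zero_le_one, fun M A _ O h A' _ O' h' x y _ => ⟨Pi.single i 1, 0, ⟨fun j => ?_, ?_⟩, ?_, ?_⟩⟩
    · by_cases hj : j = i <;> simp [hj]
    · simp
    · simp [IsLiftForm, affineForm, Pi.single_apply]
    · simp [IsLiftForm, affineForm, Pi.single_apply]
  | func f ts ih =>
    cases f with
    | zero =>
      refine ⟨0, le_rfl, fun M A _ O h A' _ O' h' x y _ => ⟨0, 0, ⟨fun j => by simp, by simp⟩, ?_, ?_⟩⟩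
      · rw [IsLiftForm, affineForm_zero, zero_smul]; exact lift_zero
      · rw [IsLiftForm, affineForm_zero, zero_smul]; exact lift_zero
    | neg =>
      obtain ⟨C, hC0, hC⟩ := ih 0
      refine ⟨C + 1, by omega, fun M A _ O h A' _ O' h' x y hs => ?_⟩
      obtain ⟨k, m, hk, h1, h2⟩ := hC M h h' x y (hs.mono (by omega) dvd_rfl)
      have e := hs.nonneg_iff (-k) (-m) (hk.neg.mono (by omega))
      rw [affineForm_neg, affineForm_neg, ← h1, ← h2] at e
      have g1 := lift_neg_cases h (letI := toStructure A O; (ts 0).realize x)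
      have g2 := lift_neg_cases h' (letI := toStructure A' O'; (ts 0).realize y)
      by_cases H : 0 ≤ - lift h (letI := toStructure A O; (ts 0).realize x)
      · rw [if_pos H] at g1
        rw [if_pos (e.1 H)] at g2
        refine ⟨0, 0, ⟨fun j => by simp; omega, by simp; omega⟩, ?_, ?_⟩
        · rw [IsLiftForm, affineForm_zero, zero_smul]; exact g1
        · rw [IsLiftForm, affineForm_zero, zero_smul]; exact g2
      · rw [if_neg H] at g1
        rw [if_neg (fun H' => H (e.2 H'))] at g2
        refine ⟨-k, -(m - 1), hk.sub_right.neg, ?_, ?_⟩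
        · rw [IsLiftForm, affineForm_neg, affineForm_sub_smul, one_smul, ← h1]; exact g1
        · rw [IsLiftForm, affineForm_neg, affineForm_sub_smul, one_smul, ← h2]; exact g2
    | add =>
      obtain ⟨C, hC0, hC⟩ := ih 0
      obtain ⟨C', hC0', hC'⟩ := ih 1
      refine ⟨C + C' + 1, by omega, fun M A _ O h A' _ O' h' x y hs => ?_⟩
      obtain ⟨k, m, hk, h1, h2⟩ := hC M h h' x y (hs.mono (by omega) dvd_rfl)
      obtain ⟨k', m', hk', h1', h2'⟩ := hC' M h h' x y (hs.mono (by omega) dvd_rfl)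
      have e := hs.nonneg_iff (k + k') (m + m' - 1) (hk.add hk').sub_right
      rw [affineForm_sub_smul, affineForm_sub_smul, affineForm_add, affineForm_add, ← h1, ← h2, ← h1',
        ← h2', one_smul, one_smul] at e
      have g1 := lift_add_cases h (letI := toStructure A O; (ts 0).realize x)
        (letI := toStructure A O; (ts 1).realize x)
      have g2 := lift_add_cases h' (letI := toStructure A' O'; (ts 0).realize y)
        (letI := toStructure A' O'; (ts 1).realize y)
      by_cases H : 0 ≤ lift h (letI := toStructure A O; (ts 0).realize x) +
        lift h (letI := toStructure A O; (ts 1).realize x) - turn h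
      · rw [if_pos H] at g1
        rw [if_pos (e.1 H)] at g2
        refine ⟨k + k', m + m' - 1, (hk.add hk').sub_right, ?_, ?_⟩
        · rw [IsLiftForm, affineForm_sub_smul, affineForm_add, one_smul, ← h1, ← h1']; exact g1
        · rw [IsLiftForm, affineForm_sub_smul, affineForm_add, one_smul, ← h2, ← h2']; exact g2
      · rw [if_neg H] at g1
        rw [if_neg (fun H' => H (e.2 H'))] at g2
        refine ⟨k + k', m + m', (hk.add hk').mono (by omega), ?_, ?_⟩
        · rw [IsLiftForm, affineForm_add, ← h1, ← h1']; exact g1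
        · rw [IsLiftForm, affineForm_add, ← h2, ← h2']; exact g2

theorem affineForm_sumElim_snoc {G : Type v} [AddCommGroup G] {α : Type} [Fintype α] {n : ℕ}
    (u : G) (k : α ⊕ Fin (n + 1) → ℤ) (m : ℤ) {X : Type w} (f : α → X) (g : Fin n → X) (a : X) (l : X → G) :
    affineForm u k m (l ∘ Sum.elim f (Fin.snoc g a : Fin (n + 1) → X)) =
      k (.inr (Fin.last n)) • l a +
        affineForm u (k ∘ Sum.map id Fin.castSucc) m (l ∘ Sum.elim f g) := by
  simp only [affineForm, Fintype.sum_sum_type, Fin.sum_univ_castSucc, Function.comp_apply,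
    Sum.elim_inl, Sum.elim_inr, Fin.snoc_castSucc, Fin.snoc_last, Sum.map_inl, Sum.map_inr, id]
  abel

theorem int_dvd_factorial {B k : ℤ} (hk : 0 < k) (hkB : k ≤ B) : k ∣ (B.toNat.factorial : ℤ) := by
  lift k to ℕ using hk.le
  rw [Int.natCast_dvd_natCast]
  exact Nat.dvd_factorial (by exact_mod_cast hk) (by omega)

/-- The truth value of a formula depends only on finitely many signs of affine forms and on residues
modulo one positive integer, uniformly in all models. -/
theorem exists_realize_iff_of_similar {e : Nat.Primes → ℕ∞} (he : ∀ p, e p = 0 ∨ e p = ⊤)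
    {α : Type} [Fintype α] {n : ℕ} (φ : langO.BoundedFormula α n) :
    ∃ B M : ℤ, 1 ≤ B ∧ 0 < M ∧ ∀ {A : Type w} [AddCommGroup A] {O : A → A → A → Prop}
      (hA : IsDivisibleModel e A O) {A' : Type w} [AddCommGroup A'] {O' : A' → A' → A' → Prop}
      (hA' : IsDivisibleModel e A' O') (f : α → A) (g : Fin n → A) (f' : α → A') (g' : Fin n → A'),
      SimilarTuple hA.orientation hA'.orientation B M (Sum.elim f g) (Sum.elim f' g') →
      ((letI := toStructure A O; φ.Realize f g) ↔ (letI := toStructure A' O'; φ.Realize f' g')) := by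
  induction φ with
  | falsum => exact ⟨1, 1, le_rfl, one_pos, fun _ _ _ _ _ _ _ _ _ _ => Iff.rfl⟩
  | equal s t =>
    obtain ⟨C, hC0, hC⟩ := exists_isLiftForm_realize.{w} s
    obtain ⟨C', hC0', hC'⟩ := exists_isLiftForm_realize.{w} t
    -- The factor 2 allows two forms to be compared; the + 1 only ensures that the bound is at least
    -- 1.
    refine ⟨2 * (C + C') + 1, 1, by omega, one_pos, fun {A} _ O hA {A'} _ O' hA' f g f' g' hs => ?_⟩
    obtain ⟨k, m, hk, h1, h2⟩ := hC 1 hA.orientation hA'.orientation _ _ (hs.mono (by omega) dvd_rfl)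
    obtain ⟨k', m', hk', h1', h2'⟩ := hC' 1 hA.orientation hA'.orientation _ _
      (hs.mono (by omega) dvd_rfl)
    have hs' := hs.mono (B := 2 * (C + C')) (by omega) dvd_rfl
    change _ = _ ↔ _ = _
    rw [← lift_inj (h := hA.orientation), ← lift_inj (h := hA'.orientation), h1, h2, h1', h2',
      le_antisymm_iff, le_antisymm_iff]
    exact and_congr (hs'.le_iff (hk.mono (by omega)) (hk'.mono (by omega)))
      (hs'.le_iff (hk'.mono (by omega)) (hk.mono (by omega)))
  | rel R ts =>
    cases R
    have := fun i => exists_isLiftForm_realize.{w} (ts i)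
    choose C hC0 hC using this
    have hle : ∀ i, C i ≤ C 0 + C 1 + C 2 := by
      have := hC0 0
      have := hC0 1
      have := hC0 2
      intro i
      fin_cases i <;> simp <;> omega
    have hnn : 0 ≤ C 0 + C 1 + C 2 := (hC0 0).trans (hle 0)
    refine ⟨2 * (C 0 + C 1 + C 2) + 1, 1, by omega, one_pos,
      fun {A} _ O hA {A'} _ O' hA' f g f' g' hs => ?_⟩
    have := fun i => hC i 1 hA.orientation hA'.orientation _ _
      (hs.mono (by have := hle i; omega) dvd_rfl)
    choose k m hk h1 h2 using this
    have hs' := hs.mono (B := 2 * (C 0 + C 1 + C 2)) (by omega) dvd_rfl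
    change O _ _ _ ↔ O' _ _ _
    rw [orient_iff (h := hA.orientation), orient_iff (h := hA'.orientation)]
    have hlt := fun i j => hs'.lt_iff ((hk i).mono (hle i)) ((hk j).mono (hle j))
    simp only [IsLiftForm] at h1 h2
    simp only [← h1, ← h2] at hlt
    exact or_congr (and_congr (hlt 0 1) (hlt 1 2)) (or_congr (and_congr (hlt 1 2) (hlt 2 0))
      (and_congr (hlt 2 0) (hlt 0 1)))
  | imp φ ψ ih1 ih2 =>
    obtain ⟨B, M, hB, hM, H⟩ := ih1
    obtain ⟨B', M', hB', hM', H'⟩ := ih2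
    refine ⟨B + B', M * M', by omega, mul_pos hM hM', fun hA _ _ _ hA' f g f' g' hs => ?_⟩
    exact imp_congr (H hA hA' f g f' g' (hs.mono (by omega) (dvd_mul_right _ _)))
      (H' hA hA' f g f' g' (hs.mono (by omega) (dvd_mul_left _ _)))
  | @all n φ ih =>
    obtain ⟨B, M, hB, hM, H⟩ := ih
    set L : ℤ := (B.toNat.factorial : ℤ)
    have hL : 0 < L := Int.natCast_pos.2 B.toNat.factorial_pos
    have hLB : 1 ≤ L * B := by nlinarith
    refine ⟨2 * (L * B), L * M, by omega, mul_pos hL hM, ?_⟩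
    have key : ∀ {A : Type w} [AddCommGroup A] {O : A → A → A → Prop}
      (hA : IsDivisibleModel e A O) {A' : Type w} [AddCommGroup A'] {O' : A' → A' → A' → Prop}
      (hA' : IsDivisibleModel e A' O') (f : α → A) (g : Fin n → A) (f' : α → A') (g' : Fin n → A'),
      SimilarTuple hA.orientation hA'.orientation (2 * (L * B)) (L * M) (Sum.elim f g)
        (Sum.elim f' g') →
      (∀ a, letI := toStructure A O; φ.Realize f (Fin.snoc g a)) →
      (∀ a', letI := toStructure A' O'; φ.Realize f' (Fin.snoc g' a')) := by
      intro A _ O hA A' _ O' hA' f g f' g' hs hall a'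
      -- The point `a'` is answered by a point on the other side; it lies in [0, turn), hence is the
      -- lift of an element of the group.
      obtain ⟨d, hd0, hd1, hres, hd⟩ := hs.symm.exists_extension hA'.isRegularlyDenseTurn
        hA.isRegularlyDenseTurn (fun m hm k => hA'.zsmul_turn_eq_smul he hA hm) hB hL hM
        (fun k hk hkB => int_dvd_factorial hk hkB) (lift_nonneg a') (lift_lt_turn a')
      have hdl := eq_lift_of_mem hd0 hd1
      generalize d.frac = a at hdl
      subst hdl
      refine (H hA hA' _ _ _ _ (Similar.symm ⟨fun k m hk => ?_, ?_⟩)).1 (hall a)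
      · rw [affineForm_sumElim_snoc, affineForm_sumElim_snoc]
        exact hd _ _ m (hk.1 _) ⟨fun i => hk.1 _, hk.2⟩
      · have hold := fun i => (hs.sameResidue i).symm.of_dvd (dvd_mul_left M L)
        rintro (i | i)
        · exact hold (.inl i)
        · refine Fin.lastCases ?_ (fun i => ?_) i
          · simpa using hres
          · simpa using hold (.inr i)
    intro A _ O hA A' _ O' hA' f g f' g' hs
    exact ⟨key hA hA' f g f' g' hs, key hA' hA f' g' f g hs.symm⟩

end Formulas

/-! ### Conditions on the cover as formulas of the group. -/

/-- A relation on tuples, given for all oriented abelian groups, is defined by one formula. -/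
def IsUniformlyDefinable {γ : Type}
    (P : ∀ (A : Type w) [AddCommGroup A], (A → A → A → Prop) → (γ → A) → Prop) : Prop :=
  ∃ ψ : langO.Formula γ, ∀ (A : Type w) [AddCommGroup A] (O : A → A → A → Prop)
    (_ : IsOrientation O) (x : γ → A), (letI := toStructure A O; ψ.Realize x) ↔ P A O x

namespace IsUniformlyDefinable

variable {γ : Type} {P Q : ∀ (A : Type w) [AddCommGroup A], (A → A → A → Prop) → (γ → A) → Prop}

theorem of_iff (hP : IsUniformlyDefinable P) (H : ∀ (A : Type w) [AddCommGroup A]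
    (O : A → A → A → Prop) (_ : IsOrientation O) (x : γ → A), P A O x ↔ Q A O x) :
    IsUniformlyDefinable Q :=
  let ⟨ψ, hψ⟩ := hP
  ⟨ψ, fun A _ O h x => (hψ A O h x).trans (H A O h x)⟩

theorem const (p : Prop) : IsUniformlyDefinable.{w} (γ := γ) fun _ _ _ _ => p := by
  by_cases hp : p
  · exact ⟨⊤, fun A _ O _ x => by simp [hp]⟩
  · exact ⟨⊥, fun A _ O _ x => by simp [hp]⟩

theorem and (hP : IsUniformlyDefinable P) (hQ : IsUniformlyDefinable Q) :
    IsUniformlyDefinable fun A _ O x => P A O x ∧ Q A O x := by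
  obtain ⟨ψ, hψ⟩ := hP
  obtain ⟨χ, hχ⟩ := hQ
  exact ⟨ψ ⊓ χ, fun A _ O h x => by
    let _ := toStructure A O
    rw [Formula.realize_inf, hψ A O h, hχ A O h]⟩

theorem not (hP : IsUniformlyDefinable P) : IsUniformlyDefinable fun A _ O x => ¬ P A O x := by
  obtain ⟨ψ, hψ⟩ := hP
  exact ⟨∼ψ, fun A _ O h x => by
    let _ := toStructure A O
    rw [Formula.realize_not, hψ A O h]⟩

theorem or (hP : IsUniformlyDefinable P) (hQ : IsUniformlyDefinable Q) :
    IsUniformlyDefinable fun A _ O x => P A O x ∨ Q A O x :=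
  (hP.not.and hQ.not).not.of_iff fun _ _ _ _ _ => by tauto

theorem imp (hP : IsUniformlyDefinable P) (hQ : IsUniformlyDefinable Q) :
    IsUniformlyDefinable fun A _ O x => P A O x → Q A O x :=
  (hP.not.or hQ).of_iff fun _ _ _ _ _ => by tauto

theorem exists_elim {P : ∀ (A : Type w) [AddCommGroup A], (A → A → A → Prop) →
    (γ ⊕ Fin 1 → A) → Prop} (hP : IsUniformlyDefinable P) :
    IsUniformlyDefinable fun A _ O x => ∃ a : A, P A O (Sum.elim x fun _ => a) := by
  obtain ⟨ψ, hψ⟩ := hP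
  refine ⟨ψ.iExs (Fin 1), fun A _ O h x => ?_⟩
  let _ := toStructure A O
  rw [Formula.realize_iExs]
  simp only [hψ A O h]
  exact ⟨fun ⟨i, hi⟩ => ⟨i 0, by
    rwa [show (fun _ => i 0) = i from funext fun j => congrArg i (Subsingleton.elim 0 j)]⟩, fun ⟨a, ha⟩ => ⟨_, ha⟩⟩

theorem forall_elim {P : ∀ (A : Type w) [AddCommGroup A], (A → A → A → Prop) →
    (γ ⊕ Fin 1 → A) → Prop} (hP : IsUniformlyDefinable P) :
    IsUniformlyDefinable fun A _ O x => ∀ a : A, P A O (Sum.elim x fun _ => a) :=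
  hP.not.exists_elim.not.of_iff fun _ _ _ _ _ => by simp

theorem realize {α : Type} (φ : langO.Formula α) (f : α → γ) :
    IsUniformlyDefinable.{w} (γ := γ) fun A _ O x => letI := toStructure A O; φ.Realize (x ∘ f) :=
  ⟨φ.relabel f, fun A _ O _ x => by
    let _ := toStructure A O
    rw [Formula.realize_relabel]⟩

theorem eq_zero (t : langO.Term γ) :
    IsUniformlyDefinable.{w} fun A _ O x => letI := toStructure A O; t.realize x = 0 :=
  ⟨t.equal zeroT, fun A _ O _ x => by
    let _ := toStructure A O
    rw [Formula.realize_equal, realize_zeroT O]⟩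

theorem orient (r s t : langO.Term γ) :
    IsUniformlyDefinable.{w} fun A _ O x => letI := toStructure A O;
      O (r.realize x) (s.realize x) (t.realize x) :=
  ⟨Relations.formula (L := langO) Rel.orient ![r, s, t], fun A _ O _ x => by
    let _ := toStructure A O
    rw [Formula.realize_rel]; exact Iff.rfl⟩

theorem cut (s t : langO.Term γ) :
    IsUniformlyDefinable.{w} fun A _ O x => letI := toStructure A O;
      Cut O (s.realize x) (t.realize x) :=
  (((eq_zero s).and (eq_zero t).not).or (orient zeroT s t)).of_iff fun _ _ _ _ _ => Iff.rfl

end IsUniformlyDefinable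

/-- A function from tuples to the cover, given for all oriented abelian groups, has a term as its
fractional part, and the bounds on its integer part are defined by formulas. -/
def IsDefinableFamily {γ : Type} (F : ∀ (A : Type w) [AddCommGroup A] (O : A → A → A → Prop)
    (h : IsOrientation O), (γ → A) → Cover h) : Prop :=
  (∃ t : langO.Term γ, ∀ (A : Type w) [AddCommGroup A] (O : A → A → A → Prop)
    (h : IsOrientation O) (x : γ → A), (F A O h x).frac = (letI := toStructure A O; t.realize x)) ∧
  -- The cover depends on a proof that `O` is an orientation. Quantifying over that proof gives a
  -- relation for every `O`, and definability is asserted only where a proof exists.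
  ∀ j : ℤ, IsUniformlyDefinable fun A _ O x => ∀ h : IsOrientation O, j ≤ (F A O h x).int

namespace IsDefinableFamily

variable {γ : Type} {F : ∀ (A : Type w) [AddCommGroup A] (O : A → A → A → Prop)
    (h : IsOrientation O), (γ → A) → Cover h}

theorem zero : IsDefinableFamily.{w} (γ := γ) fun _ _ _ _ _ => 0 :=
  ⟨⟨zeroT, fun _ _ _ _ _ => rfl⟩, fun j => (IsUniformlyDefinable.const (j ≤ 0)).of_iff
    fun _ _ _ h _ => ⟨fun H _ => H, fun H => H h⟩⟩

theorem add_lift (hF : IsDefinableFamily F) (i : γ) :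
    IsDefinableFamily fun A _ O h x => F A O h x + lift h (x i) := by
  obtain ⟨⟨t, ht⟩, hj⟩ := hF
  refine ⟨⟨addT t (Term.var i), fun A _ O h x => ?_⟩, fun j => ?_⟩
  · rw [frac_add, ht A O h x]; rfl
  -- The integer part grows by the carry: the bound `j` is reached already, or `j - 1` is reached
  -- and the sum overflows.
  · refine ((hj j).or ((hj (j - 1)).and (IsUniformlyDefinable.cut (addT t (Term.var i)) t))).of_iff
      fun A _ O h x => ?_
    have e : Cut O (letI := toStructure A O; (addT t (Term.var i)).realize x)
      (letI := toStructure A O; t.realize x) ↔ Cut O ((F A O h x).frac + x i) (F A O h x).frac := by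
      rw [ht A O h x]; rfl
    rw [e]
    constructor
    · intro H _
      rw [int_add, carry, int_lift, frac_lift]
      rcases H with H | ⟨H, H'⟩
      · have := H h
        split_ifs <;> omega
      · have := H h
        rw [if_pos H']
        omega
    · intro H
      have H := H h
      rw [int_add, carry, int_lift, frac_lift] at H
      split_ifs at H with H'
      · exact .inr ⟨fun _ => by omega, H'⟩
      · exact .inl fun _ => by omega

theorem neg (hF : IsDefinableFamily F) : IsDefinableFamily fun A _ O h x => - F A O h x := by
  obtain ⟨⟨t, ht⟩, hj⟩ := hF
  refine ⟨⟨negT t, fun A _ O h x => ?_⟩, fun j => ?_⟩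
  · rw [frac_neg, ht A O h x]; rfl
  · have d := IsUniformlyDefinable.eq_zero t
    -- Negation sends the integer part i to -i if the fractional part is zero and to -i - 1
    -- otherwise, which shifts the negated bound by one.
    refine ((d.and (hj (1 - j)).not).or (d.not.and (hj (-j)).not)).of_iff fun A _ O h x => ?_
    rw [← ht A O h x]
    simp only [forall_prop_of_true h, int_neg, h.carry_neg]
    by_cases h0 : (F A O h x).frac = 0 <;> simp [h0] <;> omega

theorem add_turn (hF : IsDefinableFamily F) (m : ℤ) :
    IsDefinableFamily fun A _ O h x => F A O h x + m • turn h := by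
  obtain ⟨⟨t, ht⟩, hj⟩ := hF
  refine ⟨⟨t, fun A _ O h x => ?_⟩, fun j => ?_⟩
  · rw [← ht A O h x]; simp only [add_zsmul_turn]
  · refine (hj (j - m)).of_iff fun A _ O h x => ?_
    simp only [forall_prop_of_true h, add_zsmul_turn]
    omega

theorem congr (hF : IsDefinableFamily F) {F' : ∀ (A : Type w) [AddCommGroup A]
    (O : A → A → A → Prop) (h : IsOrientation O), (γ → A) → Cover h}
    (H : ∀ (A : Type w) [AddCommGroup A] (O : A → A → A → Prop) (h : IsOrientation O) (x : γ → A),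
      F A O h x = F' A O h x) : IsDefinableFamily F' := by
  obtain rfl : F = F' := by funext A _ O h x; exact H A O h x
  exact hF

theorem add_nsmul_lift (hF : IsDefinableFamily F) (k : ℕ) (i : γ) :
    IsDefinableFamily fun A _ O h x => F A O h x + k • lift h (x i) := by
  induction k with
  | zero => exact hF.congr fun A _ O h x => by simp
  | succ k ih => exact (ih.add_lift i).congr fun A _ O h x => by rw [succ_nsmul, add_assoc]

theorem add_zsmul_lift (hF : IsDefinableFamily F) (k : ℤ) (i : γ) :
    IsDefinableFamily fun A _ O h x => F A O h x + k • lift h (x i) := by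
  obtain ⟨n, rfl | rfl⟩ := k.eq_nat_or_neg
  · exact (hF.add_nsmul_lift n i).congr fun A _ O h x => by simp
  · exact (hF.neg.add_nsmul_lift n i).neg.congr fun A _ O h x => by simp [add_comm]

theorem affineForm {ι : Type} [Fintype ι] (f : ι → γ) (k : ι → ℤ) (m : ℤ) :
    IsDefinableFamily.{w} fun _ _ _ h x => affineForm (turn h) k m (lift h ∘ x ∘ f) := by
  classical
  have key : ∀ s : Finset ι, IsDefinableFamily.{w} fun _ _ _ h x =>
      ∑ i ∈ s, k i • (lift h ∘ x ∘ f) i := by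
    intro s
    induction s using Finset.induction_on with
    | empty => exact zero.congr fun A _ O h x => by simp
    | insert i s hi ih =>
      exact (ih.add_zsmul_lift (k i) (f i)).congr fun A _ O h x => by
        rw [Finset.sum_insert hi, add_comm]; rfl
  exact (key Finset.univ).add_turn m

theorem nonneg (hF : IsDefinableFamily F) :
    IsUniformlyDefinable fun A _ O x => ∀ h : IsOrientation O, 0 ≤ F A O h x :=
  (hF.2 0).of_iff fun A _ O h x => by simp only [nonneg_iff]

end IsDefinableFamily

namespace IsUniformlyDefinable

variable {γ ι : Type} [Fintype ι]

theorem affineForm_sumElim {G : Type v} [AddCommGroup G] (u : G) (L : ℤ) (k : ι → ℤ) (m : ℤ)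
    {X : Type w} (a : Fin 1 → X) (b : ι → X) (l : X → G) :
    affineForm u (Sum.elim (fun _ => L) k) m (l ∘ Sum.elim a b) =
      L • l (a 0) + affineForm u k m (l ∘ b) := by
  simp [affineForm, add_assoc]

theorem affineForm_le (L : ℤ) (i : γ) (f : ι → γ) (k : ι → ℤ) (m : ℤ) :
    IsUniformlyDefinable.{w} fun _ _ O x => ∀ h : IsOrientation O,
      affineForm (turn h) k m (lift h ∘ x ∘ f) ≤ L • lift h (x i) := by
  refine (IsDefinableFamily.affineForm (Sum.elim (fun _ : Fin 1 => i) f)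
    (Sum.elim (fun _ => L) (-k)) (-m)).nonneg.of_iff fun A _ O h x => ?_
  refine forall_congr' fun h => ?_
  rw [Sum.comp_elim, affineForm_sumElim, affineForm_neg, ← sub_eq_add_neg, sub_nonneg]
  rfl

theorem le_affineForm (L : ℤ) (i : γ) (f : ι → γ) (k : ι → ℤ) (m : ℤ) :
    IsUniformlyDefinable.{w} fun _ _ O x => ∀ h : IsOrientation O,
      L • lift h (x i) ≤ affineForm (turn h) k m (lift h ∘ x ∘ f) := by
  refine (IsDefinableFamily.affineForm (Sum.elim (fun _ : Fin 1 => i) f)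
    (Sum.elim (fun _ => -L) k) m).nonneg.of_iff fun A _ O h x => ?_
  refine forall_congr' fun h => ?_
  rw [Sum.comp_elim, affineForm_sumElim, neg_smul, neg_add_eq_sub, sub_nonneg]
  rfl

theorem eq_affineForm (L : ℤ) (i : γ) (f : ι → γ) (k : ι → ℤ) (m : ℤ) :
    IsUniformlyDefinable.{w} fun _ _ O x => ∀ h : IsOrientation O,
      L • lift h (x i) = affineForm (turn h) k m (lift h ∘ x ∘ f) :=
  ((le_affineForm L i f k m).and (affineForm_le L i f k m)).of_iff fun A _ O h x => by
    simp only [forall_prop_of_true h, le_antisymm_iff]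

theorem affineForm_lt (L : ℤ) (i : γ) (f : ι → γ) (k : ι → ℤ) (m : ℤ) :
    IsUniformlyDefinable.{w} fun _ _ O x => ∀ h : IsOrientation O,
      affineForm (turn h) k m (lift h ∘ x ∘ f) < L • lift h (x i) :=
  (le_affineForm L i f k m).not.of_iff fun A _ O h x => by
    simp only [forall_prop_of_true h, not_le]

theorem lift_lt_lift (i j : γ) : IsUniformlyDefinable.{w} fun _ _ O x => ∀ h : IsOrientation O,
    lift h (x i) < lift h (x j) :=
  (cut (Term.var i) (Term.var j)).of_iff fun A _ O h x => by
    simp only [forall_prop_of_true h, Cover.lift_lt_lift]; rfl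

theorem exists_smul_lift_eq (M t : ℤ) (i : γ) :
    IsUniformlyDefinable.{w} fun A _ O x => ∀ h : IsOrientation O,
      ∃ a : A, M • lift h a = lift h (x i) + t • turn h := by
  refine (eq_affineForm (γ := γ ⊕ Fin 1) M (.inr 0) (fun _ : Fin 1 => .inl i) (fun _ => 1)
    t).exists_elim.of_iff fun A _ O h x => ?_
  simp [forall_prop_of_true h, OrientedGroup.affineForm]

end IsUniformlyDefinable

/-! ### Types over finite parameter sets. -/

theorem IsRegularlyDenseTurn.sameResidue_self {G : Type v} [AddCommGroup G] [LinearOrder G] {u : G}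
    (hu : IsRegularlyDenseTurn u) {M : ℤ} (hM : 0 < M) (x : G) : SameResidue u u M x x :=
  let ⟨t, ht⟩ := hu.exists_add_zsmul M hM x
  ⟨t, ht, ht⟩

/-- Every element of the cover between `0` and the full turn is congruent modulo `M` to a multiple of
the full turn, with a bounded factor and a lift as witness. -/
theorem IsDivisibleModel.exists_smul_lift_eq {e : Nat.Primes → ℕ∞} {A : Type w} [AddCommGroup A]
    {O : A → A → A → Prop} (hA : IsDivisibleModel e A O) {M : ℤ} (hM : 0 < M) (a : A) :
    ∃ t : ℤ, 0 ≤ t ∧ t < M ∧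
      ∃ b : A, M • lift hA.orientation b = lift hA.orientation a + t • turn hA.orientation := by
  obtain ⟨b, hb⟩ := hA.exists_zsmul_eq hM a
  obtain ⟨t, ht⟩ := exists_turn_of_frac_eq (x := M • lift hA.orientation b)
    (y := lift hA.orientation a) (by rw [frac_zsmul, frac_lift, hb, frac_lift])
  refine ⟨t, ?_, ?_, b, ht⟩
  · have h1 : (0 : Cover hA.orientation) ≤ lift hA.orientation a + t • turn hA.orientation := by
      rw [← ht]; exact zsmul_nonneg (lift_nonneg b) hM.le
    rw [nonneg_iff, add_zsmul_turn] at h1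
    simpa using h1
  · by_contra hc
    rw [not_lt] at hc
    have h1 : M • turn hA.orientation ≤ lift hA.orientation a + t • turn hA.orientation := by
      rw [← int_le_iff, add_zsmul_turn]; simpa using hc
    rw [← ht, zsmul_le_zsmul_iff_right hM] at h1
    exact absurd (lift_lt_turn b) (not_lt.2 h1)

/-- For 0 ≤ t < M the witness `g` itself lies in [0, turn), so a quantifier over `A` is enough to
express the residue class. -/
theorem exists_lift_eq_of_smul {A : Type w} [AddCommGroup A] {O : A → A → A → Prop}
    {h : IsOrientation O} {M t : ℤ} (hM : 0 < M) (ht : 0 ≤ t) (htM : t < M) {a : A} {g : Cover h}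
    (hg : lift h a + t • turn h = M • g) : ∃ b, M • lift h b = lift h a + t • turn h := by
  refine ⟨g.frac, ?_⟩
  rw [eq_lift_of_mem, hg]
  · rw [← nonneg_zsmul_iff hM, ← hg]
    exact add_nonneg (lift_nonneg a) (zsmul_nonneg turn_pos.le ht)
  · rw [← zsmul_lt_zsmul_iff_right hM, ← hg]
    have h1 : (t + 1) • turn h ≤ M • turn h := zsmul_le_zsmul_left turn_pos.le (by omega)
    rw [add_zsmul, one_zsmul, add_comm] at h1
    exact (add_lt_add_left (lift_lt_turn a) _).trans_le h1

theorem exists_realize_iff_of_similar_finset {e : Nat.Primes → ℕ∞} (he : ∀ p, e p = 0 ∨ e p = ⊤)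
    {α : Type} [Fintype α] (Δ : Finset (langO.Formula α)) :
    ∃ B M : ℤ, 1 ≤ B ∧ 0 < M ∧ ∀ φ ∈ Δ, ∀ {A : Type w} [AddCommGroup A] {O : A → A → A → Prop}
      (hA : IsDivisibleModel e A O) (f f' : α → A),
      SimilarTuple hA.orientation hA.orientation B M f f' →
      ((letI := toStructure A O; φ.Realize f) ↔ (letI := toStructure A O; φ.Realize f')) := by
  choose B M hB hM H using fun φ : langO.Formula α => exists_realize_iff_of_similar.{w} he φ
  refine ⟨1 + ∑ φ ∈ Δ, B φ, ∏ φ ∈ Δ, M φ, ?_, Finset.prod_pos fun φ _ => hM φ, ?_⟩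
  · have : 0 ≤ ∑ φ ∈ Δ, B φ := Finset.sum_nonneg fun φ _ => by have := hB φ; omega
    omega
  intro φ hφ A _ O hA f f' hs
  have h1 : B φ ≤ ∑ φ ∈ Δ, B φ :=
    Finset.single_le_sum (f := B) (fun φ _ => by have := hB φ; omega) hφ
  have hs := hs.mono (B := B φ) (by omega) (Finset.dvd_prod_of_mem M hφ)
  refine H φ hA hA f default f' default ⟨fun k m hk => ?_, ?_⟩
  · have := hs.nonneg_iff (k ∘ Sum.inl) m ⟨fun i => hk.1 _, hk.2⟩
    simpa [affineForm] using this
  · rintro (i | i)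
    · exact hs.sameResidue i
    · exact i.elim0

/-- If `lift a` and `lift a'` have the same residue and the same cut, then `a, b` and `a', b` are
similar. -/
theorem similarTuple_sumElim {e : Nat.Primes → ℕ∞} {A : Type w} [AddCommGroup A]
    {O : A → A → A → Prop} (hA : IsDivisibleModel e A O) {B L M : ℤ} (hL : 0 < L) (hM : 0 < M)
    (hdvd : ∀ k : ℤ, 0 < k → k ≤ B → k ∣ L) {n : ℕ} (b : Fin n → A) {a a' : Fin 1 → A}
    (hres : SameResidue (turn hA.orientation) (turn hA.orientation) M (lift hA.orientation (a 0))
      (lift hA.orientation (a' 0)))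
    (hle : ∀ k m, CoeffBound (L * B) k m →
      (affineForm (turn hA.orientation) k m (lift hA.orientation ∘ b) ≤
          L • lift hA.orientation (a 0) ↔
        affineForm (turn hA.orientation) k m (lift hA.orientation ∘ b) ≤
          L • lift hA.orientation (a' 0)))
    (hge : ∀ k m, CoeffBound (L * B) k m →
      (L • lift hA.orientation (a 0) ≤
          affineForm (turn hA.orientation) k m (lift hA.orientation ∘ b) ↔
        L • lift hA.orientation (a' 0) ≤
          affineForm (turn hA.orientation) k m (lift hA.orientation ∘ b))) :
    SimilarTuple hA.orientation hA.orientation B M (Sum.elim a b) (Sum.elim a' b) := by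
  refine ⟨fun k m hk => ?_, ?_⟩
  · have e : k = Sum.elim (fun _ => k (.inl 0)) (k ∘ Sum.inr) := by
      ext (i | i)
      · rw [Subsingleton.elim i 0]; rfl
      · rfl
    rw [e, IsUniformlyDefinable.affineForm_sumElim, IsUniformlyDefinable.affineForm_sumElim]
    exact nonneg_smul_add_affineForm_iff hL hdvd (fun _ _ _ => Iff.rfl) hle hge (hk.1 (.inl 0))
      ⟨fun i => hk.1 (.inr i), hk.2⟩
  · rintro (i | i)
    · rw [Subsingleton.elim i 0]; exact hres
    · exact hA.isRegularlyDenseTurn.sameResidue_self hM _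

/-- `φ♯` for the point `x` with `L • lift x` equal to the affine form `k`, `m` in the parameter. -/
def AtPoint (L : ℤ) {n : ℕ} (k : Fin n → ℤ) (m : ℤ) (φ : langO.Formula (Fin 1 ⊕ Fin n))
    (A : Type w) [AddCommGroup A] (O : A → A → A → Prop) (x : Fin n ⊕ (Fin 1 × Fin n) → A) : Prop :=
  ∃ a : A, (∀ h : IsOrientation O,
      L • lift h a = affineForm (turn h) k m (lift h ∘ fun j => x (.inr (0, j)))) ∧
    letI := toStructure A O; φ.Realize (Sum.elim (fun _ => a) fun j => x (.inl j))

/-- `φ♯` for the points `x` in the residue class `t` such that `L • lift x` is immediately above the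
affine form `k`, `m` in the parameter. -/
def RightOf (L M t : ℤ) {n : ℕ} (k : Fin n → ℤ) (m : ℤ) (φ : langO.Formula (Fin 1 ⊕ Fin n))
    (A : Type w) [AddCommGroup A] (O : A → A → A → Prop) (x : Fin n ⊕ (Fin 1 × Fin n) → A) : Prop :=
  -- The bound `a₀` stands in for the nearest form above, which would cost a second parameter.
  ∃ a₀ : A, (∀ h : IsOrientation O,
      affineForm (turn h) k m (lift h ∘ fun j => x (.inr (0, j))) < L • lift h a₀) ∧
    ∀ a : A, (∀ h : IsOrientation O,
        affineForm (turn h) k m (lift h ∘ fun j => x (.inr (0, j))) < L • lift h a) →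
      (∀ h : IsOrientation O, lift h a < lift h a₀) →
      (∀ h : IsOrientation O, ∃ b : A, M • lift h b = lift h a + t • turn h) →
      letI := toStructure A O; φ.Realize (Sum.elim (fun _ => a) fun j => x (.inl j))

theorem isUniformlyDefinable_atPoint (L : ℤ) {n : ℕ} (k : Fin n → ℤ) (m : ℤ)
    (φ : langO.Formula (Fin 1 ⊕ Fin n)) : IsUniformlyDefinable.{w} (AtPoint L k m φ) := by
  have h1 := IsUniformlyDefinable.eq_affineForm.{w} (γ := (Fin n ⊕ (Fin 1 × Fin n)) ⊕ Fin 1) L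
    (.inr 0) (fun j : Fin n => .inl (.inr (0, j))) k m
  have h2 := IsUniformlyDefinable.realize.{w} (γ := (Fin n ⊕ (Fin 1 × Fin n)) ⊕ Fin 1) φ
    (Sum.elim (fun _ => .inr 0) (fun j : Fin n => .inl (.inl j)))
  refine (h1.and h2).exists_elim.of_iff fun A _ O h x => ?_
  simp only [Sum.comp_elim]
  rfl

theorem isUniformlyDefinable_rightOf (L M t : ℤ) {n : ℕ} (k : Fin n → ℤ) (m : ℤ)
    (φ : langO.Formula (Fin 1 ⊕ Fin n)) : IsUniformlyDefinable.{w} (RightOf L M t k m φ) := by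
  have h1 := IsUniformlyDefinable.affineForm_lt.{w} (γ := (Fin n ⊕ (Fin 1 × Fin n)) ⊕ Fin 1) L
    (.inr 0) (fun j : Fin n => .inl (.inr (0, j))) k m
  have h2 := IsUniformlyDefinable.affineForm_lt.{w}
    (γ := ((Fin n ⊕ (Fin 1 × Fin n)) ⊕ Fin 1) ⊕ Fin 1) L
    (.inr 0) (fun j : Fin n => .inl (.inl (.inr (0, j)))) k m
  have h3 := IsUniformlyDefinable.lift_lt_lift.{w}
    (γ := ((Fin n ⊕ (Fin 1 × Fin n)) ⊕ Fin 1) ⊕ Fin 1) (.inr 0) (.inl (.inr 0))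
  have h4 := IsUniformlyDefinable.exists_smul_lift_eq.{w}
    (γ := ((Fin n ⊕ (Fin 1 × Fin n)) ⊕ Fin 1) ⊕ Fin 1) M t (.inr 0)
  have h5 := IsUniformlyDefinable.realize.{w} (γ := ((Fin n ⊕ (Fin 1 × Fin n)) ⊕ Fin 1) ⊕ Fin 1) φ
    (Sum.elim (fun _ => .inr 0) (fun j : Fin n => .inl (.inl (.inl j))))
  refine (h1.and (h2.imp (h3.imp (h4.imp h5))).forall_elim).exists_elim.of_iff fun A _ O h x => ?_
  simp only [Sum.comp_elim]
  rfl

section Types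

variable {e : Nat.Primes → ℕ∞} {A : Type w} [AddCommGroup A] {O : A → A → A → Prop}
  (hA : IsDivisibleModel e A O) {B L M : ℤ} {n : ℕ} {Δ : Finset (langO.Formula (Fin 1 ⊕ Fin n))}

theorem realize_iff_atPoint (hL : 0 < L) {k : Fin n → ℤ} {m : ℤ} {a : A} {b c : Fin n → A}
    (hac : affineForm (turn hA.orientation) k m (lift hA.orientation ∘ c) = L • lift hA.orientation a)
    (φ : langO.Formula (Fin 1 ⊕ Fin n)) :
    (letI := toStructure A O; φ.Realize (Sum.elim (fun _ => a) b)) ↔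
      AtPoint L k m φ A O (Sum.elim b fun p => c p.2) := by
  constructor
  · exact fun H => ⟨a, fun _ => hac.symm, H⟩
  · rintro ⟨a', ha', H⟩
    have h1 := (ha' hA.orientation).trans hac
    rw [zsmul_right_inj hL.ne', lift_inj] at h1
    exact h1 ▸ H

/-- No form in the parameters takes a value in the gap between the maximal one and `L • lift a`, so
all points of the residue class in that gap satisfy the same instances as `a`. One direction takes
`a₀ = a`; the other finds a point of the class below both `a₀` and `a`. -/
theorem realize_iff_rightOf (hL : 0 < L) (hM : 0 < M) (hdvd : ∀ k : ℤ, 0 < k → k ≤ B → k ∣ L)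
    {P : Set (Fin n → A)} {φ : langO.Formula (Fin 1 ⊕ Fin n)}
    (hφ : ∀ f f' : Fin 1 ⊕ Fin n → A, SimilarTuple hA.orientation hA.orientation B M f f' →
      ((letI := toStructure A O; φ.Realize f) ↔ (letI := toStructure A O; φ.Realize f')))
    {a : A} {t : ℤ} (ht0 : 0 ≤ t) (htM : t < M)
    (ht : ∃ b : A, M • lift hA.orientation b = lift hA.orientation a + t • turn hA.orientation)
    (hne : ∀ b ∈ P, ∀ k m, CoeffBound (L * B) k m →
      affineForm (turn hA.orientation) k m (lift hA.orientation ∘ b) ≠ L • lift hA.orientation a)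
    {k : Fin n → ℤ} {m : ℤ} {c : Fin n → A}
    (hc0 : 0 ≤ affineForm (turn hA.orientation) k m (lift hA.orientation ∘ c))
    (hca : affineForm (turn hA.orientation) k m (lift hA.orientation ∘ c) <
      L • lift hA.orientation a)
    (hmax : ∀ b ∈ P, ∀ k' m', CoeffBound (L * B) k' m' →
      affineForm (turn hA.orientation) k' m' (lift hA.orientation ∘ b) < L • lift hA.orientation a →
      affineForm (turn hA.orientation) k' m' (lift hA.orientation ∘ b) ≤
        affineForm (turn hA.orientation) k m (lift hA.orientation ∘ c))
    {b : Fin n → A} (hb : b ∈ P) :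
    (letI := toStructure A O; φ.Realize (Sum.elim (fun _ => a) b)) ↔
      RightOf L M t k m φ A O (Sum.elim b fun p => c p.2) := by
  have h := hA.orientation
  have key : ∀ a' : A, affineForm (turn h) k m (lift h ∘ c) < L • lift h a' → lift h a' < lift h a →
      (∃ b : A, M • lift h b = lift h a' + t • turn h) →
      ((letI := toStructure A O; φ.Realize (Sum.elim (fun _ => a) b)) ↔
        (letI := toStructure A O; φ.Realize (Sum.elim (fun _ => a') b))) := by
    intro a' h1 h2 ⟨g', hg'⟩
    obtain ⟨g, hg⟩ := ht
    have h2' := zsmul_lt_zsmul_right hL h2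
    refine hφ _ _ (similarTuple_sumElim hA hL hM hdvd b ⟨t, ⟨_, hg.symm⟩, _, hg'.symm⟩
      (fun k' m' hk' => ?_) fun k' m' hk' => ?_)
    · constructor
      · intro H
        exact (hmax b hb k' m' hk' (lt_of_le_of_ne H (hne b hb k' m' hk'))).trans h1.le
      · exact fun H => H.trans h2'.le
    · constructor
      · exact fun H => h2'.le.trans H
      · intro H
        by_contra hc
        exact absurd (h1.trans_le H) (not_lt.2 (hmax b hb k' m' hk' (not_le.1 hc)))
  constructor
  · intro H
    refine ⟨a, fun _ => hca, fun a' h1 h2 h3 => (key a' (h1 h) (h2 h) (h3 h)).1 H⟩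
  · rintro ⟨a₀, h0, H⟩
    have h0' : affineForm (turn h) k m (lift h ∘ c) < L • lift h a₀ := h0 h
    have hlt : affineForm (turn h) k m (lift h ∘ c) < L • min (lift h a₀) (lift h a) := by
      rcases min_choice (lift h a₀) (lift h a) with hm | hm <;> rw [hm] <;> assumption
    obtain ⟨d, hd, hd', g, hg⟩ := hA.isRegularlyDenseTurn.exists_residue_between hL hM hlt t
    rw [zsmul_lt_zsmul_iff_right hL, lt_min_iff] at hd'
    -- Nonnegativity of the form keeps the point found by density inside [0, turn), so that it is a
    -- lift.
    have hd0 : 0 ≤ d := (nonneg_zsmul_iff hL).1 (hc0.trans hd.le)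
    have hdl := eq_lift_of_mem hd0 (hd'.1.trans (lift_lt_turn a₀))
    generalize d.frac = a' at hdl
    subst hdl
    have hr := exists_lift_eq_of_smul hM ht0 htM hg
    exact (key a' hd hd'.2 hr).2 (H a' (fun _ => hd) (fun _ => hd'.1) fun _ => hr)

end Types

theorem hasUDTFS_theoryT {e : Nat.Primes → ℕ∞} (he : ∀ p, e p = 0 ∨ e p = ⊤) {n : ℕ}
    (Δ : Finset (langO.Formula (Fin 1 ⊕ Fin n))) : VCd.HasUDTFS.{0, 0, w} (theoryT e) Δ 1 := by
  classical
  obtain ⟨B, M, hB, hM, hΔ⟩ := exists_realize_iff_of_similar_finset.{w} he Δ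
  set L : ℤ := (B.toNat.factorial : ℤ)
  have hL : 0 < L := Int.natCast_pos.2 B.toNat.factorial_pos
  have hdvd : ∀ k : ℤ, 0 < k → k ≤ B → k ∣ L := fun k hk hkB => int_dvd_factorial hk hkB
  have hLB : 1 ≤ L * B := by nlinarith
  let K := {p : (Fin n → ℤ) × ℤ | CoeffBound (L * B) p.1 p.2}
  have : Finite K := coeffBound_finite (L * B)
  -- One family for each form and each choice of either equality (`none`) or a residue class just
  -- above the form.
  obtain ⟨N, ⟨ε⟩⟩ := Finite.exists_equiv_fin (K × Option (Fin M.toNat))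
  choose F₁ hF₁ using fun (p : K) φ => isUniformlyDefinable_atPoint.{w} L p.1.1 p.1.2 φ
  choose F₂ hF₂ using fun (p : K) (t : Fin M.toNat) φ =>
    isUniformlyDefinable_rightOf.{w} L M t p.1.1 p.1.2 φ
  let F : K × Option (Fin M.toNat) → langO.Formula (Fin 1 ⊕ Fin n) →
      langO.Formula (Fin n ⊕ (Fin 1 × Fin n)) := fun p φ => p.2.elim (F₁ p.1 φ) fun t => F₂ p.1 t φ
  refine ⟨N, fun i => F (ε.symm i), fun A S _ hT P hP hPne q hq => ?_⟩
  obtain ⟨G, O, rfl, hnt, hO, hR, hD, hE⟩ := (model_theoryT_iff e A).1 hT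
  let _ := toStructure A O
  have hA : IsDivisibleModel e A O := ⟨hnt, hO, hR, hD, hE⟩
  -- Both `Δ` and `P` are finite, so the whole type is realized by one element.
  obtain ⟨a', ha'⟩ := hq.2 (Δ ×ˢ hP.toFinset) (by simp)
  obtain ⟨a, rfl⟩ : ∃ a, (fun _ => a) = a' := ⟨a' 0, funext fun i => congrArg a' (Subsingleton.elim 0 i)⟩
  suffices H : ∃ (p : K × Option (Fin M.toNat)), ∃ c ∈ P, ∀ φ ∈ Δ, ∀ b ∈ P,
      (φ.Realize (Sum.elim (fun _ => a) b) ↔ (F p φ).Realize (Sum.elim b fun p => c p.2)) by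
    obtain ⟨p, c, hc, H⟩ := H
    refine ⟨ε p, fun _ => c, fun _ => hc, fun φ hφ b hb => ?_⟩
    simp only [ε.symm_apply_apply]
    exact (ha' (φ, b) (by simp [hφ, hb])).trans (H φ hφ b hb)
  by_cases hex : ∃ c ∈ P, ∃ k m, CoeffBound (L * B) k m ∧
      affineForm (turn hO) k m (lift hO ∘ c) = L • lift hO a
  · obtain ⟨c, hc, k, m, hkm, hac⟩ := hex
    exact ⟨(⟨(k, m), hkm⟩, none), c, hc, fun φ hφ b hb =>
      (realize_iff_atPoint hA hL hac φ).trans (hF₁ ⟨(k, m), hkm⟩ φ A O hO _).symm⟩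
  · push Not at hex
    obtain ⟨t, ht0, htM, ht⟩ := hA.exists_smul_lift_eq hM a
    lift t to ℕ using ht0
    obtain ⟨c₀, hc₀⟩ := hPne
    -- The zero form is a candidate, since `L • lift a` is not a form value and so is positive.
    -- Hence the maximum exists and is nonnegative.
    have b0 : CoeffBound (ι := Fin n) (L * B) 0 0 := ⟨fun i => by simp; omega, by simp; omega⟩
    have h0 : (0 : Cover hO) < L • lift hO a := by
      refine lt_of_le_of_ne (zsmul_nonneg (lift_nonneg a) hL.le) ?_
      simpa [affineForm_zero] using hex c₀ hc₀ 0 0 b0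
    obtain ⟨⟨c, k, m⟩, ⟨⟨hc, hkm⟩, hca⟩, hmax⟩ := Set.exists_max_image
      {p : (Fin n → A) × (Fin n → ℤ) × ℤ | p ∈ P ×ˢ K ∧
        affineForm (turn hO) p.2.1 p.2.2 (lift hO ∘ p.1) < L • lift hO a}
      (fun p => affineForm (turn hO) p.2.1 p.2.2 (lift hO ∘ p.1))
      ((hP.prod (coeffBound_finite (L * B))).subset fun p hp => hp.1)
      ⟨(c₀, 0, 0), ⟨hc₀, b0⟩, by simpa [affineForm_zero] using h0⟩
    refine ⟨(⟨(k, m), hkm⟩, some ⟨t, by omega⟩), c, hc, fun φ hφ b hb =>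
      (realize_iff_rightOf hA hL hM hdvd (hΔ φ hφ hA) (Int.natCast_nonneg t) htM ht hex ?_ hca
        (fun b hb k' m' hk' hlt => hmax (b, k', m') ⟨⟨hb, hk'⟩, hlt⟩) hb).trans
        (hF₂ ⟨(k, m), hkm⟩ ⟨t, by omega⟩ φ A O hO _).symm⟩
    have := hmax (c₀, 0, 0) ⟨⟨hc₀, b0⟩, by simpa [affineForm_zero] using h0⟩
    simpa [affineForm_zero] using this

/-! ### A model made of real numbers modulo the integers. -/

section Existence

/-- A linear projection of the reals onto the rationals has a nonzero kernel. -/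
theorem exists_linearMap_real_rat :
    ∃ (π : ℝ →ₗ[ℚ] ℚ) (w : ℝ), (∀ q : ℚ, π q = q) ∧ 0 < w ∧ π w = 0 := by
  obtain ⟨π, hπ⟩ := LinearMap.exists_leftInverse_of_injective (Algebra.linearMap ℚ ℝ)
    (LinearMap.ker_eq_bot.2 (algebraMap ℚ ℝ).injective)
  have h1 : ∀ q : ℚ, π q = q := fun q => LinearMap.congr_fun hπ q
  have h2 : √2 - (π √2 : ℚ) ≠ 0 := fun H =>
    (irrational_sqrt_two.ne_rat _) (sub_eq_zero.1 H)
  have h3 : π (√2 - (π √2 : ℚ)) = 0 := by rw [map_sub, h1, sub_self]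
  rcases lt_or_gt_of_ne h2 with h | h
  · exact ⟨π, _, h1, neg_pos.2 h, by rw [map_neg, h3, neg_zero]⟩
  · exact ⟨π, _, h1, h, h3⟩

/-- Let R be the ring of rationals with a denominator prime to every p with `e p = 0`, and let D be
its preimage under the projection π. The kernel of π is a nonzero ℚ-space, which makes every nD
dense, even for R = ℤ. The torsion modulo ℤ is that of R/ℤ, which has p-torsion exactly when `e p =
⊤`. -/
theorem exists_addSubgroup_real {e : Nat.Primes → ℕ∞} (he : ∀ p, e p = 0 ∨ e p = ⊤) :
    ∃ D : AddSubgroup ℝ, (1 : ℝ) ∈ D ∧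
      (∀ (p : Nat.Primes), ∀ x ∈ D, ∃ t : ℤ, ∃ g ∈ D, x + t = p * g) ∧
      (∀ n : ℕ, 0 < n → ∀ x y : ℝ, x < y → ∃ g ∈ D, x < n * g ∧ n * g < y) ∧
      (∀ p : Nat.Primes, e p = 0 → ∀ g ∈ D, ∀ n : ℤ, p * g = n → ∃ z : ℤ, g = z) ∧
      ∀ p : Nat.Primes, e p = ⊤ → ∀ k : ℕ, (1 / (p : ℝ) ^ k) ∈ D := by
  obtain ⟨π, w, hπ, hw0, hw⟩ := exists_linearMap_real_rat
  have hπn : ∀ (m : ℤ) (x : ℝ), π (m * x) = m * π x := fun m x => by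
    rw [← zsmul_eq_mul, map_zsmul, zsmul_eq_mul]
  have hπz : ∀ m : ℤ, π m = m := fun m => by simpa using hπ m
  have hcop : ∀ {p : Nat.Primes} {d : ℕ}, ¬ (p : ℕ) ∣ d → ∃ a b : ℤ, a * p + b * d = 1 := by
    intro p d hd
    have := (Nat.Prime.coprime_iff_not_dvd p.2).2 hd
    exact Nat.isCoprime_iff_coprime.2 this
  let D : AddSubgroup ℝ :=
    { carrier := {x | ∃ d : ℕ, d ≠ 0 ∧ (∀ p : Nat.Primes, e p = 0 → ¬ (p : ℕ) ∣ d) ∧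
        ∃ n : ℤ, d * π x = n}
      zero_mem' := ⟨1, one_ne_zero, fun p _ h => p.2.one_lt.ne' (Nat.dvd_one.1 h), 0, by simp⟩
      add_mem' := by
        rintro x y ⟨d, hd0, hd, n, hn⟩ ⟨d', hd0', hd', n', hn'⟩
        refine ⟨d * d', mul_ne_zero hd0 hd0', fun p hp h => ?_, d' * n + d * n', ?_⟩
        · exact (p.2.dvd_mul.1 h).elim (hd p hp) (hd' p hp)
        · push_cast
          rw [map_add, ← hn, ← hn']; ring
      neg_mem' := by
        rintro x ⟨d, hd0, hd, n, hn⟩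
        exact ⟨d, hd0, hd, -n, by rw [map_neg, mul_neg, hn]; simp⟩ }
  have one_dvd : ∀ p : Nat.Primes, e p = 0 → ¬ (p : ℕ) ∣ 1 :=
    fun p _ h => p.2.one_lt.ne' (Nat.dvd_one.1 h)
  refine ⟨D, ⟨1, one_ne_zero, one_dvd, 1, by simpa using hπz 1⟩, ?_, ?_, ?_, ?_⟩
  · rintro p x ⟨d, hd0, hd, n, hn⟩
    have hp0 : (p : ℝ) ≠ 0 := by exact_mod_cast p.2.ne_zero
    have hp0' : (p : ℚ) ≠ 0 := by exact_mod_cast p.2.ne_zero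
    have hdiv : ∀ y : ℝ, (p : ℚ) * π (y / p) = π y := fun y => by
      have := hπn p (y / p)
      rw [Int.cast_natCast, mul_div_cancel₀ _ hp0] at this
      simpa using this.symm
    rcases he p with h0 | h0
    · obtain ⟨a, b, hab⟩ := hcop (hd p h0)
      have hab' : (a : ℚ) * p + b * d = 1 := by exact_mod_cast hab
      -- With ap + bd = 1 and dπ(x) = n, subtracting nb leaves d(π(x) - nb) = n(1 - bd) = pna, which
      -- is divisible by p.
      refine ⟨-n * b, (x + (-n * b : ℤ)) / p, ⟨d, hd0, hd, n * a, ?_⟩, by field_simp⟩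
      apply mul_left_cancel₀ hp0'
      rw [mul_left_comm, hdiv, map_add, hπz, mul_add, hn]
      push_cast
      linear_combination (-(n : ℚ)) * hab'
    · refine ⟨0, x / p, ⟨p * d, mul_ne_zero p.2.ne_zero hd0, fun q hq h => ?_, n, ?_⟩, by
        field_simp; simp⟩
      · rcases q.2.dvd_mul.1 h with h | h
        · have := (Nat.prime_dvd_prime_iff_eq q.2 p.2).1 h
          rw [Subtype.ext this, h0] at hq
          exact absurd hq (by simp)
        · exact hd q hq h
      · rw [← hn, ← hdiv x]; push_cast; ring
  · intro n hn x y hxy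
    obtain ⟨q, hq, hq'⟩ := exists_rat_btwn ((div_lt_div_iff_of_pos_right hw0).2 hxy)
    have hn0 : (n : ℝ) ≠ 0 := by exact_mod_cast hn.ne'
    have e1 : (n : ℝ) * ((q / n) * w) = q * w := by field_simp
    refine ⟨(q / n) * w, ⟨1, one_ne_zero, one_dvd, 0, ?_⟩, ?_, ?_⟩
    · have : ((q : ℝ) / n) * w = (q / n : ℚ) • w := by rw [Rat.smul_def]; push_cast; rfl
      rw [this, map_smul, hw]; simp
    · rw [e1]; exact (div_lt_iff₀ hw0).1 hq
    · rw [e1]; exact (lt_div_iff₀ hw0).1 hq'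
  · rintro p hp g ⟨d, hd0, hd, j, hj⟩ n hn
    obtain ⟨a, b, hab⟩ := hcop (hd p hp)
    have hab' : (a : ℚ) * p + b * d = 1 := by exact_mod_cast hab
    have h1 : (p : ℚ) * π g = n := by
      have := hπn p g
      rw [Int.cast_natCast, hn, hπz] at this
      simpa using this.symm
    have h2 : π g = (a * n + b * j : ℤ) := by
      push_cast
      rw [← h1, ← hj]
      linear_combination (-π g) * hab'
    refine ⟨a * n + b * j, ?_⟩
    have hp0 : (p : ℝ) ≠ 0 := by exact_mod_cast p.2.ne_zero
    apply mul_left_cancel₀ hp0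
    rw [hn]
    rw [h2] at h1
    exact_mod_cast h1.symm
  · intro p hp k
    refine ⟨p ^ k, pow_ne_zero _ p.2.ne_zero, fun q hq h => ?_, 1, ?_⟩
    · have := (Nat.prime_dvd_prime_iff_eq q.2 p.2).1 (q.2.dvd_of_dvd_pow h)
      rw [Subtype.ext this, hp] at hq
      exact absurd hq (by simp)
    · have h1 : (1 / (p : ℝ) ^ k) = ((1 / (p : ℚ) ^ k : ℚ) : ℝ) := by push_cast; rfl
      have hp0 : (p : ℚ) ≠ 0 := by exact_mod_cast p.2.ne_zero
      rw [h1, hπ]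
      push_cast
      field_simp

variable {D : AddSubgroup ℝ}

/-- The quotient of a subgroup of the reals by the integers, as a group of angles. -/
abbrev Angles (h1 : (1 : ℝ) ∈ D) : Type := D ⧸ AddSubgroup.zmultiples (⟨1, h1⟩ : D)

namespace Angles

variable {h1 : (1 : ℝ) ∈ D}

/-- The projection of the subgroup of the reals onto the group of angles. -/
abbrev mk (h1 : (1 : ℝ) ∈ D) : D →+ Angles h1 := QuotientAddGroup.mk' _

theorem mk_surjective (a : Angles h1) : ∃ x, mk h1 x = a := QuotientAddGroup.mk'_surjective _ a

theorem mk_eq_zero_iff {x : D} : mk h1 x = 0 ↔ ∃ n : ℤ, (x : ℝ) = n := by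
  rw [QuotientAddGroup.mk'_apply, QuotientAddGroup.eq_zero_iff, AddSubgroup.mem_zmultiples_iff]
  refine exists_congr fun n => ?_
  rw [Subtype.ext_iff, eq_comm]
  simp

theorem mk_eq_iff {x y : D} : mk h1 x = mk h1 y ↔ ∃ n : ℤ, (x : ℝ) = y + n := by
  rw [← sub_eq_zero, ← map_sub, mk_eq_zero_iff]
  simp [sub_eq_iff_eq_add']

theorem eq_of_mk_eq {x y : D} (h : mk h1 x = mk h1 y) (hxy : (x : ℝ) < y + 1) (hyx : (y : ℝ) < x + 1) :
    x = y := by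
  obtain ⟨n, hn⟩ := mk_eq_iff.1 h
  have a1 : (n : ℝ) < 1 := by linarith
  have a2 : (-1 : ℝ) < n := by linarith
  have a3 : n < 1 := by exact_mod_cast a1
  have a4 : -1 < n := by exact_mod_cast a2
  obtain rfl : n = 0 := by omega
  exact Subtype.ext (by simpa using hn)

/-- The orientation of the group of angles. -/
def Orient (h1 : (1 : ℝ) ∈ D) (a b c : Angles h1) : Prop :=
  ∃ x y z : D, mk h1 x = a ∧ mk h1 y = b ∧ mk h1 z = c ∧ (x : ℝ) < y ∧ (y : ℝ) < z ∧ (z : ℝ) < x + 1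

theorem exists_mem_Ico (a : Angles h1) : ∃ x, mk h1 x = a ∧ (0 : ℝ) ≤ x ∧ (x : ℝ) < 1 := by
  obtain ⟨x, rfl⟩ := mk_surjective a
  refine ⟨x - ⌊(x : ℝ)⌋ • ⟨1, h1⟩, mk_eq_iff.2 ⟨-⌊(x : ℝ)⌋, by simp [sub_eq_add_neg]⟩, ?_, ?_⟩
  · simp
  · have := Int.lt_floor_add_one (x : ℝ)
    simp only [AddSubgroup.coe_sub, AddSubgroup.coe_zsmul, zsmul_eq_mul, mul_one]
    linarith

theorem exists_mem_Ioo {a : Angles h1} (ha : a ≠ 0) :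
    ∃ x, mk h1 x = a ∧ (0 : ℝ) < x ∧ (x : ℝ) < 1 := by
  obtain ⟨x, rfl, h0, hx⟩ := exists_mem_Ico a
  refine ⟨x, rfl, lt_of_le_of_ne h0 fun H => ha ?_, hx⟩
  exact mk_eq_zero_iff.2 ⟨0, by simpa using H.symm⟩

theorem orient_zero_iff {a b : Angles h1} : Orient h1 0 a b ↔
    ∃ x y : D, mk h1 x = a ∧ mk h1 y = b ∧ (0 : ℝ) < x ∧ (x : ℝ) < y ∧ (y : ℝ) < 1 := by
  constructor
  · rintro ⟨z, x, y, hz, rfl, rfl, hx, hxy, hy⟩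
    refine ⟨x - z, y - z, by rw [map_sub, hz, sub_zero], by rw [map_sub, hz, sub_zero], ?_, ?_, ?_⟩ <;>
      simp only [AddSubgroup.coe_sub] <;> linarith
  · rintro ⟨x, y, rfl, rfl, hx, hxy, hy⟩
    exact ⟨0, x, y, map_zero _, rfl, rfl, by simpa using hx, hxy, by simpa using hy⟩

theorem isOrientation_orient : IsOrientation (Orient h1) := by
  have hd : ∀ a b c, Orient h1 a b c → a ≠ b ∧ b ≠ c ∧ a ≠ c := by
    rintro _ _ _ ⟨x, y, z, rfl, rfl, rfl, hxy, hyz, hz⟩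
    refine ⟨fun H => ?_, fun H => ?_, fun H => ?_⟩ <;>
      · have := congrArg Subtype.val (eq_of_mk_eq H (by linarith) (by linarith))
        linarith
  refine ⟨hd, ?_, ?_, { trichotomous := fun a b hab hba => ?_
                        irrefl := fun a h => h.1 rfl
                        trans := fun a b c hab hbc => ?_ }⟩
  · rintro _ _ _ ⟨x, y, z, rfl, rfl, rfl, hxy, hyz, hz⟩
    refine ⟨y, z, x + ⟨1, h1⟩, rfl, rfl, mk_eq_iff.2 ⟨1, by simp⟩, hyz, ?_, ?_⟩ <;> simpa
  · rintro _ _ _ d ⟨x, y, z, rfl, rfl, rfl, hxy, hyz, hz⟩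
    obtain ⟨d, rfl⟩ := mk_surjective d
    refine ⟨x + d, y + d, z + d, map_add _ _ _, map_add _ _ _, map_add _ _ _, ?_, ?_, ?_⟩ <;>
      simp only [AddSubgroup.coe_add] <;> linarith
  · obtain ⟨x, hx, hx0, hx1⟩ := exists_mem_Ioo a.2
    obtain ⟨y, hy, hy0, hy1⟩ := exists_mem_Ioo b.2
    by_contra hne
    have hne' : a.1 ≠ b.1 := fun H => hne (Subtype.ext H)
    rcases lt_trichotomy (x : ℝ) y with h | h | h
    · exact hab ⟨hne', orient_zero_iff.2 ⟨x, y, hx, hy, hx0, h, hy1⟩⟩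
    · exact hne' (by rw [← hx, ← hy, Subtype.ext h])
    · exact hba ⟨hne'.symm, orient_zero_iff.2 ⟨y, x, hy, hx, hy0, h, hx1⟩⟩
  · obtain ⟨x, y, hx, hy, hx0, hxy, hy1⟩ := orient_zero_iff.1 hab.2
    obtain ⟨y', z, hy', hz, hy0', hyz, hz1⟩ := orient_zero_iff.1 hbc.2
    obtain rfl := eq_of_mk_eq (hy.trans hy'.symm) (by linarith) (by linarith)
    have H : Orient h1 0 a c := orient_zero_iff.2 ⟨x, z, hx, hz, hx0, hxy.trans hyz, hz1⟩
    exact ⟨(hd _ _ _ H).2.1, H⟩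

end Angles

theorem exists_isDivisibleModel {e : Nat.Primes → ℕ∞} (he : ∀ p, e p = 0 ∨ e p = ⊤) :
    ∃ (A : Type) (_ : AddCommGroup A) (O : A → A → A → Prop), IsDivisibleModel e A O := by
  obtain ⟨D, h1, hdiv, hdense, htor0, htor⟩ := exists_addSubgroup_real he
  refine ⟨Angles h1, inferInstance, Angles.Orient h1, ?_, Angles.isOrientation_orient, ?_, ?_, ?_⟩
  · obtain ⟨g, hg, hg0, hg1⟩ := hdense 1 one_pos 0 1 one_pos
    rw [Nat.cast_one, one_mul] at hg0 hg1
    refine nontrivial_of_ne (Angles.mk h1 ⟨g, hg⟩) 0 fun H => ?_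
    obtain ⟨n, hn⟩ := Angles.mk_eq_zero_iff.1 H
    rw [show g = n from hn] at hg0 hg1
    have a1 : 0 < n := by exact_mod_cast hg0
    have a2 : n < 1 := by exact_mod_cast hg1
    omega
  · intro p hp a b hab
    obtain ⟨x, y, rfl, rfl, hx0, hxy, hy1⟩ := Angles.orient_zero_iff.1 hab
    obtain ⟨g, hg, hg0, hg1⟩ := hdense p hp.pos x y hxy
    have hgpos : 0 < g := by
      have : 0 < (p : ℝ) * g := hx0.trans hg0
      exact (pos_iff_pos_of_mul_pos this).1 (by exact_mod_cast hp.pos)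
    refine ⟨Angles.mk h1 ⟨g, hg⟩, ⟨x, p • ⟨g, hg⟩, y, rfl, map_nsmul _ _ _, rfl, ?_, ?_, by linarith⟩,
      fun i hi hip => ?_⟩
    · simpa using hg0
    · simpa using hg1
    -- The multiples up to pg stay below y < 1, so they do not wrap around.
    · have H : Angles.Orient h1 0 (i • Angles.mk h1 ⟨g, hg⟩) ((i + 1) • Angles.mk h1 ⟨g, hg⟩) := by
        refine Angles.orient_zero_iff.2 ⟨i • ⟨g, hg⟩, (i + 1) • ⟨g, hg⟩, map_nsmul _ _ _,
          map_nsmul _ _ _, ?_, ?_, ?_⟩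
        · have : (0 : ℝ) < i := by exact_mod_cast hi
          simpa using mul_pos this hgpos
        · simp [add_mul, hgpos]
        · have : ((i + 1 : ℕ) : ℝ) ≤ p := by
            have := hp.one_lt
            exact_mod_cast (by omega : i + 1 ≤ p)
          have := mul_le_mul_of_nonneg_right this hgpos.le
          simp at this ⊢
          linarith
      exact ⟨(Angles.isOrientation_orient.distinct _ _ _ H).2.1, H⟩
  · intro p
    rw [AddSubgroup.index_eq_one, AddSubgroup.eq_top_iff']
    intro a
    obtain ⟨x, rfl⟩ := Angles.mk_surjective a
    obtain ⟨t, g, hg, htg⟩ := hdiv p x x.2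
    refine ⟨Angles.mk h1 ⟨g, hg⟩, ?_⟩
    rw [nsmulAddMonoidHom_apply, ← map_nsmul, Angles.mk_eq_iff]
    exact ⟨t, by simpa using htg.symm⟩
  · intro p
    rw [torsionExponent_eq_iff]
    have hp0 : (p : ℝ) ≠ 0 := by exact_mod_cast p.2.ne_zero
    rcases he p with h0 | h0
    · refine ⟨fun k hk => absurd hk (by simp [h0]), fun k hk a ha => ?_⟩
      rw [h0] at hk
      obtain rfl : k = 0 := by exact_mod_cast hk
      obtain ⟨x, rfl⟩ := Angles.mk_surjective a
      rw [← map_nsmul, Angles.mk_eq_zero_iff] at ha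
      obtain ⟨n, hn⟩ := ha
      rw [pow_zero, one_nsmul, Angles.mk_eq_zero_iff]
      exact htor0 p h0 x x.2 n (by simpa using hn)
    · refine ⟨fun k _ H => ?_, fun k hk => absurd hk (by simp [h0])⟩
      -- The class of 1/p^(k+1) is killed by p^(k+1) but not by p^k.
      have h2 := H (Angles.mk h1 ⟨_, htor p h0 (k + 1)⟩)
      rw [← map_nsmul, ← map_nsmul, Angles.mk_eq_zero_iff, Angles.mk_eq_zero_iff] at h2
      obtain ⟨n, hn⟩ := h2 ⟨1, by simp; field_simp⟩
      have h3 : (1 : ℝ) = n * p := by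
        rw [← hn]
        simp only [AddSubgroup.coe_nsmul, nsmul_eq_mul, Nat.cast_pow]
        field_simp
        ring
      have h4 : (1 : ℤ) = n * p := by exact_mod_cast h3
      have h5 : (p : ℤ) ∣ 1 := ⟨n, by rw [h4]; ring⟩
      have := Int.le_of_dvd one_pos h5
      have := p.2.two_le
      omega

end Existence

/-! ### Completeness and the final theorem. -/

theorem isComplete_theoryT {e : Nat.Primes → ℕ∞} (he : ∀ p, e p = 0 ∨ e p = ⊤) :
    (theoryT e).IsComplete := by
  rw [Theory.IsComplete.isComplete_iff_models_elementarily_equivalent]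
  constructor
  · obtain ⟨A, _, O, hA⟩ := exists_isDivisibleModel he
    let _ := toStructure A O
    have : A ⊨ theoryT e := (model_theoryT_iff e A).2 ⟨_, O, rfl, hA.nontrivial, hA.orientation,
      hA.regularlyDense, hA.index_eq_one, hA.torsionExponent_eq⟩
    exact ⟨Theory.ModelType.of _ A⟩
  · intro A A'
    rw [elementarilyEquivalent_iff]
    intro φ
    obtain ⟨B, M, -, hM, H⟩ := exists_realize_iff_of_similar.{0} he φ
    obtain @⟨A, S, hS, _⟩ := A
    obtain @⟨A', S', hS', _⟩ := A'
    obtain ⟨G, O, rfl, hnt, hO, hR, hD, hE⟩ := (model_theoryT_iff e A).1 hS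
    obtain ⟨G', O', rfl, hnt', hO', hR', hD', hE'⟩ := (model_theoryT_iff e A').1 hS'
    -- Without variables the only forms are `m • turn`, with the sign of `m`, and there are no
    -- residues to match, so the empty tuples of any two models are similar.
    refine H ⟨hnt, hO, hR, hD, hE⟩ ⟨hnt', hO', hR', hD', hE'⟩ _ _ _ _ ⟨fun k m _ => ?_, ?_⟩
    · simp only [affineForm, Fintype.sum_empty, zero_add, nonneg_iff, int_zsmul_turn]
    · rintro (i | i)
      · exact i.elim
      · exact i.elim0

end OrientedGroup

theorem theorem1p2 (e : Nat.Primes → ℕ∞) (he : ∀ p, e p = 0 ∨ e p = ⊤) :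
    VCd.HasVCProperty.{0, 0, w} (OrientedGroup.theoryT e) 1 :=
  ⟨OrientedGroup.isComplete_theoryT he, fun _ Δ => OrientedGroup.hasUDTFS_theoryT he Δ⟩
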